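/- Let $M$ be an $n$-dimensional oriented smooth Riemannian manifold (without boundary; Hausdorff and $\sigma$-compact, not necessarily compact or connected), let $\alpha,\beta>0$, and let $\mathbb K=\mathbb R$ or $\mathbb C$. Write $\Omega^p(M,\mathbb K)$ for the smooth $\mathbb K$-valued $p$-forms on $M$, $d$ for the exterior derivative, and $\delta:\Omega^{p+1}(M,\mathbb K)\to\Omega^{p}(M,\mathbb K)$ for its formal adjoint, i.e. the linear operator (which exists for every $p\ge 0$) with $(d\omega,\eta)=(\omega,\delta\eta)$ for all $\eta\in\Omega^{p+1}(M,\mathbb K)$ and all compactly supported $\omega\in\Omega^p(M,\mathbb K)$, where $(\omega,\eta)=\int_M\langle\omega,\eta\rangle\,d\mathrm{vol}$. Let $$F_{\alpha\beta,p}=\alpha\, d\delta+\beta\,\delta d:\Omega^p(M,\mathbb K)\to\Omega^p(M,\mathbb K)$$ (for $p=0$ the first summand is zero), and let its spectrum be the weighted set $$\mathrm{Spec}(F_{\alpha\beta,p})(\lambda)=\dim_{\mathbb K}\{\omega\in\Omega^p(M,\mathbb K)\mid F_{\alpha\beta,p}\,\omega=\lambda\omega\},\qquad \lambda\in\mathbb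 K .$$ (For compact $M$ these dimensions are finite; in general they are taken as cardinal numbers.) Then for every $0\le p\le n$: 1. the Hodge star is a linear isomorphism $*_p:\Omega^p(M,\mathbb K)\to\Omega^{n-p}(M,\mathbb K)$, and $*_p\,F_{\alpha\beta,p}\,*_p^{-1}=F_{\beta\alpha,n-p}$; 2. $\mathrm{Spec}(F_{\alpha\beta,p})=\mathrm{Spec}(F_{\beta\alpha,n-p})$. In particular, if $n=2p$, then $\mathrm{Spec}(F_{\alpha\beta,p})=\mathrm{Spec}(F_{\beta\alpha,p})$. -/

import Mathlib

open Bundle Manifold MeasureTheory Set Module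
open scoped ContDiff Topology

namespace GenHodge

noncomputable section

/-! ### Linear algebra on one oriented Euclidean vector space

`𝕜` is `ℝ` or `ℂ`; a `𝕜`-valued real alternating map is an element of `Λᵖ V* ⊗ 𝕜`. -/

section LinearAlgebra

theorem append_update_right {V : Type*} {p q : ℕ} [DecidableEq (Fin q)] (u : Fin p → V)
    (v : Fin q → V) (i : Fin q) (z : V) :
    (fun k => Fin.append u (Function.update v i z) k) =
      Function.update (Fin.append u v) (Fin.natAdd p i) z := by
  ext k
  refine Fin.addCases (fun j => ?_) (fun j => ?_) k
  · have : Fin.castAdd q j ≠ Fin.natAdd p i := by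
      intro h
      have := congrArg Fin.val h
      simp at this
      omega
    simp [Function.update_of_ne this]
  · by_cases hj : j = i
    · subst hj
      simp
    · have : Fin.natAdd p j ≠ Fin.natAdd p i := by simpa using hj
      simp [Function.update_of_ne this, Function.update_of_ne hj]

variable {𝕜 : Type*} [RCLike 𝕜]
variable {V : Type*} [NormedAddCommGroup V] [InnerProductSpace ℝ V] [FiniteDimensional ℝ V]

/-- The inner product on `Λᵖ V* ⊗ 𝕜` (Hermitian if `𝕜 = ℂ`) for which the
`e^{i₁} ∧ ⋯ ∧ e^{iₚ}`, `i₁ < ⋯ < iₚ`, are orthonormal. The sum over all multi-indices counts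
each increasing one `p!` times. -/
def formInner {p : ℕ} (θ η : V [⋀^Fin p]→L[ℝ] 𝕜) : 𝕜 :=
  ((p.factorial : ℕ) : 𝕜)⁻¹ * ∑ f : Fin p → Fin (finrank ℝ V),
    θ (fun i => stdOrthonormalBasis ℝ V (f i)) *
      (starRingEnd 𝕜) (η (fun i => stdOrthonormalBasis ℝ V (f i)))

/-- The Hodge star `Λᵖ V* ⊗ 𝕜 → Λ^q V* ⊗ 𝕜`, `p + q = n = dim V`, characterised by
`α ∧ ⋆β = ⟨α, β⟩ vol` for real `α`, `β` and extended `𝕜`-linearly. Explicitly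
`(⋆η)(v₁, …, v_q) = ∑_{i₁ < ⋯ < iₚ} η(e_{i₁}, …, e_{iₚ}) vol(e_{i₁}, …, e_{iₚ}, v₁, …, v_q)`. -/
def hodgeStar {n p q : ℕ} [Fact (finrank ℝ V = n)] (o : Orientation ℝ V (Fin n))
    (h : p + q = n) (η : V [⋀^Fin p]→L[ℝ] 𝕜) : V [⋀^Fin q]→L[ℝ] 𝕜 where
  toFun v := ((p.factorial : ℕ) : 𝕜)⁻¹ * ∑ f : Fin p → Fin (finrank ℝ V),
    η (fun i => stdOrthonormalBasis ℝ V (f i)) *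
      ((o.volumeForm (fun k => Fin.append (fun i => stdOrthonormalBasis ℝ V (f i)) v
        (Fin.cast h.symm k)) : ℝ) : 𝕜)
  map_update_add' := by
    intro _ v i x y
    subst h
    rw [← mul_add, ← Finset.sum_add_distrib]
    congr 1
    refine Finset.sum_congr rfl fun f _ => ?_
    rw [← mul_add, ← RCLike.ofReal_add]
    congr 2
    simp only [Fin.cast_eq_self, append_update_right]
    exact o.volumeForm.map_update_add _ _ _ _
  map_update_smul' := by
    intro _ v i c x
    subst h
    rw [mul_comm _ (Finset.sum _ _), mul_comm _ (Finset.sum _ _), ← smul_mul_assoc,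
      Finset.smul_sum]
    congr 1
    refine Finset.sum_congr rfl fun f _ => ?_
    rw [← mul_smul_comm]
    congr 1
    simp only [Fin.cast_eq_self, append_update_right]
    rw [o.volumeForm.map_update_smul, RCLike.real_smul_eq_coe_mul]
    simp
  map_eq_zero_of_eq' := by
    intro v i j hv hij
    subst h
    rw [Finset.sum_eq_zero, mul_zero]
    intro f _
    have : o.volumeForm (fun k => Fin.append (fun i => stdOrthonormalBasis ℝ V (f i)) v
        (Fin.cast rfl k)) = 0 := by
      refine o.volumeForm.map_eq_zero_of_eq _ (i := Fin.natAdd p i) (j := Fin.natAdd p j) ?_ ?_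
      · simpa using hv
      · simpa using hij
    rw [this]; simp
  cont := by
    have hvol : Continuous (fun w : Fin n → V => o.volumeForm w) :=
      (o.volumeForm.mkContinuous 1 (fun w => by
        simpa using o.abs_volumeForm_apply_le w)).cont
    refine continuous_const.mul (continuous_finsetSum _ fun f _ => continuous_const.mul ?_)
    refine RCLike.continuous_ofReal.comp (hvol.comp ?_)
    refine continuous_pi fun k => ?_
    generalize Fin.cast h.symm k = k'
    refine Fin.addCases (fun j => ?_) (fun j => ?_) k'
    · simpa using continuous_const
    · simpa using continuous_apply j

end LinearAlgebra

/-! ### Differential forms on a smooth manifold -/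

set_option synthInstance.maxHeartbeats 200000 in
theorem contDiffOn_extDeriv {E F : Type*} [NormedAddCommGroup E] [NormedSpace ℝ E]
    [NormedAddCommGroup F] [NormedSpace ℝ F] {p : ℕ} {η : E → E [⋀^Fin p]→L[ℝ] F} {s : Set E}
    (hs : IsOpen s) (hη : ContDiffOn ℝ ∞ η s) : ContDiffOn ℝ ∞ (extDeriv η) s := by
  have h := ContinuousLinearMap.contDiff (n := ∞) (𝕜 := ℝ)
    (E := E →L[ℝ] E [⋀^Fin p]→L[ℝ] F) (F := E [⋀^Fin (p + 1)]→L[ℝ] F)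
    (ContinuousAlternatingMap.alternatizeUncurryFinCLM (n := p) ℝ E F)
  exact h.comp_contDiffOn (hη.fderiv_of_isOpen hs (by simp))

section Forms

variable {n : ℕ} {𝕜 : Type*} [RCLike 𝕜]
variable {M : Type*} [TopologicalSpace M] [ChartedSpace (EuclideanSpace ℝ (Fin n)) M]

/-- The expression of a (not necessarily smooth) `p`-form in the chart `φ` around `c`,
i.e. the pullback `(φ⁻¹)^* θ`. -/
def localRep {p : ℕ} (θ : ∀ x : M, TangentSpace (𝓡 n) x [⋀^Fin p]→L[ℝ] 𝕜) (c : M)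
    (y : EuclideanSpace ℝ (Fin n)) : EuclideanSpace ℝ (Fin n) [⋀^Fin p]→L[ℝ] 𝕜 :=
  (θ ((extChartAt (𝓡 n) c).symm y)).compContinuousLinearMap
    (mfderiv 𝓘(ℝ, EuclideanSpace ℝ (Fin n)) (𝓡 n) (extChartAt (𝓡 n) c).symm y)

variable (n 𝕜 M) in
/-- `Ωᵖ(M, 𝕜)`: the smooth `𝕜`-valued differential `p`-forms on `M`. -/
def SmoothForm (p : ℕ) :
    Submodule 𝕜 (∀ x : M, TangentSpace (𝓡 n) x [⋀^Fin p]→L[ℝ] 𝕜) where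
  carrier := {θ | ∀ c : M, ContDiffOn ℝ ∞ (localRep θ c) (extChartAt (𝓡 n) c).target}
  add_mem' := fun {a b} ha hb c => (ha c).add (hb c)
  zero_mem' := fun c => by
    have : localRep (0 : ∀ x : M, TangentSpace (𝓡 n) x [⋀^Fin p]→L[ℝ] 𝕜) c = fun _ => 0 := by
      ext; rfl
    rw [this]
    exact contDiffOn_const
  smul_mem' := fun k θ hθ c => (hθ c).const_smul k

/-- `θ` is compactly supported. -/
def HasCompactSupp {p : ℕ} (θ : SmoothForm n 𝕜 M p) : Prop :=
  IsCompact (closure {x : M | θ.1 x ≠ 0})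

/-- The exterior derivative at `x`, computed in the preferred chart at `x`. -/
def extDerivAt {p : ℕ} (θ : ∀ x : M, TangentSpace (𝓡 n) x [⋀^Fin p]→L[ℝ] 𝕜) (x : M) :
    TangentSpace (𝓡 n) x [⋀^Fin (p + 1)]→L[ℝ] 𝕜 :=
  (extDeriv (localRep θ x) (extChartAt (𝓡 n) x x)).compContinuousLinearMap
    (mfderiv (𝓡 n) 𝓘(ℝ, EuclideanSpace ℝ (Fin n)) (extChartAt (𝓡 n) x) x)

variable [IsManifold (𝓡 n) ∞ M]

/-- In any chart, the exterior derivative is the usual one on `ℝⁿ`. -/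
theorem localRep_extDerivAt {p : ℕ} (θ : SmoothForm n 𝕜 M p) (c : M)
    {y : EuclideanSpace ℝ (Fin n)} (hy : y ∈ (extChartAt (𝓡 n) c).target) :
    localRep (extDerivAt θ.1) c y = extDeriv (localRep θ.1 c) y := by
  set x : M := (extChartAt (𝓡 n) c).symm y with hx
  set φ := extChartAt (𝓡 n) c with hφ
  set ψ := extChartAt (𝓡 n) x with hψ
  have hxψ : x ∈ ψ.source := mem_extChartAt_source x
  have hsymm : ∀ (a : M) {z : EuclideanSpace ℝ (Fin n)}, z ∈ (extChartAt (𝓡 n) a).target →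
      ContMDiffAt 𝓘(ℝ, EuclideanSpace ℝ (Fin n)) (𝓡 n) ∞ (extChartAt (𝓡 n) a).symm z :=
    fun a z hz => (contMDiffOn_extChartAt_symm a).contMDiffAt
      ((isOpen_extChartAt_target a).mem_nhds hz)
  have hchart : ∀ (a : M) {b : M}, b ∈ (extChartAt (𝓡 n) a).source →
      ContMDiffAt (𝓡 n) 𝓘(ℝ, EuclideanSpace ℝ (Fin n)) ∞ (extChartAt (𝓡 n) a) b :=
    fun a b hb => contMDiffAt_extChartAt' (by rwa [extChartAt_source] at hb)
  let f : EuclideanSpace ℝ (Fin n) → EuclideanSpace ℝ (Fin n) := fun z => ψ (φ.symm z)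
  have hfy : f y = ψ x := rfl
  have hU : ∀ᶠ z in 𝓝 y, z ∈ φ.target ∧ φ.symm z ∈ ψ.source := by
    refine ((isOpen_extChartAt_target c).eventually_mem hy).and ?_
    exact (hsymm c hy).continuousAt.eventually_mem ((isOpen_extChartAt_source x).mem_nhds hxψ)
  have hf : ContDiffAt ℝ ∞ f y :=
    ((hchart x hxψ).comp y (hsymm c hy)).contDiffAt
  have hfd : fderiv ℝ f y = (mfderiv (𝓡 n) 𝓘(ℝ, EuclideanSpace ℝ (Fin n)) ψ x).comp
      (mfderiv 𝓘(ℝ, EuclideanSpace ℝ (Fin n)) (𝓡 n) φ.symm y) := by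
    rw [← mfderiv_eq_fderiv]
    exact mfderiv_comp y ((hchart x hxψ).mdifferentiableAt (by simp))
      ((hsymm c hy).mdifferentiableAt (by simp))
  have hloc : (fun z => (localRep θ.1 x (f z)).compContinuousLinearMap (fderiv ℝ f z)) =ᶠ[𝓝 y]
      localRep θ.1 c := by
    filter_upwards [hU] with z hz
    have hfz : f z ∈ ψ.target := ψ.map_source hz.2
    have hback : ψ.symm (f z) = φ.symm z := ψ.left_inv hz.2
    have hd : mfderiv 𝓘(ℝ, EuclideanSpace ℝ (Fin n)) (𝓡 n) φ.symm z =
        (mfderiv 𝓘(ℝ, EuclideanSpace ℝ (Fin n)) (𝓡 n) ψ.symm (f z)).comp (fderiv ℝ f z) := by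
      have hev : φ.symm =ᶠ[𝓝 z] ψ.symm ∘ f := by
        have : ∀ᶠ w in 𝓝 z, φ.symm w ∈ ψ.source :=
          (hsymm c hz.1).continuousAt.eventually_mem ((isOpen_extChartAt_source x).mem_nhds hz.2)
        filter_upwards [this] with w hw using (ψ.left_inv hw).symm
      have h1 := hev.mfderiv_eq (I := 𝓘(ℝ, EuclideanSpace ℝ (Fin n))) (I' := 𝓡 n)
      have h2 := mfderiv_comp z ((hsymm x hfz).mdifferentiableAt (by simp))
        (((hchart x hz.2).comp z (hsymm c hz.1)).mdifferentiableAt (by simp))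
      rw [mfderiv_eq_fderiv] at h2
      exact h1.trans h2
    have aux : ∀ (b : M) (_ : b = φ.symm z)
        (L : TangentSpace 𝓘(ℝ, EuclideanSpace ℝ (Fin n)) z →L[ℝ] TangentSpace (𝓡 n) b)
        (L' : TangentSpace 𝓘(ℝ, EuclideanSpace ℝ (Fin n)) z →L[ℝ]
          TangentSpace (𝓡 n) (φ.symm z)) (_ : (L : EuclideanSpace ℝ (Fin n) →L[ℝ]
            EuclideanSpace ℝ (Fin n)) = L'),
        (θ.1 b).compContinuousLinearMap L = (θ.1 (φ.symm z)).compContinuousLinearMap L' := by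
      rintro b rfl L L' h
      exact congrArg (fun L => (θ.1 (φ.symm z)).compContinuousLinearMap L) h
    exact aux _ hback _ _ hd.symm
  have hdiff : DifferentiableAt ℝ (localRep θ.1 x) (f y) :=
    ((θ.2 x).contDiffAt ((isOpen_extChartAt_target x).mem_nhds
      (ψ.map_source hxψ))).differentiableAt (by simp)
  have hpull := extDeriv_pullback hdiff hf (by simpa using ENat.LEInfty.out)
  rw [← hloc.extDeriv_eq, hpull, hfd]
  rfl

theorem extDerivAt_mem {p : ℕ} (θ : SmoothForm n 𝕜 M p) :
    extDerivAt θ.1 ∈ SmoothForm n 𝕜 M (p + 1) := by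
  intro c
  refine ContDiffOn.congr (f := extDeriv (localRep θ.1 c)) ?_
    fun y hy => localRep_extDerivAt θ c hy
  exact contDiffOn_extDeriv (isOpen_extChartAt_target c) (θ.2 c)

variable (n 𝕜 M) in
/-- The exterior derivative `d : Ωᵖ(M, 𝕜) → Ωᵖ⁺¹(M, 𝕜)`. -/
def extD (p : ℕ) : SmoothForm n 𝕜 M p →ₗ[𝕜] SmoothForm n 𝕜 M (p + 1) where
  toFun θ := ⟨extDerivAt θ.1, extDerivAt_mem θ⟩
  map_add' a b := by
    have hd : ∀ (a : SmoothForm n 𝕜 M p) (x : M),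
        DifferentiableAt ℝ (localRep a.1 x) (extChartAt (𝓡 n) x x) := fun a x =>
      ((a.2 x).contDiffAt (extChartAt_target_mem_nhds x)).differentiableAt (by simp)
    refine Subtype.ext (funext fun x => ?_)
    change extDerivAt (a.1 + b.1) x = extDerivAt a.1 x + extDerivAt b.1 x
    have h : localRep (a.1 + b.1) x = localRep a.1 x + localRep b.1 x := rfl
    rw [extDerivAt, h, extDeriv_add (hd a x) (hd b x)]
    rfl
  map_smul' k a := by
    refine Subtype.ext (funext fun x => ?_)
    change extDerivAt (k • a.1) x = k • extDerivAt a.1 x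
    have hd : DifferentiableAt ℝ (localRep a.1 x) (extChartAt (𝓡 n) x x) :=
      ((a.2 x).contDiffAt (extChartAt_target_mem_nhds x)).differentiableAt (by simp)
    have h : localRep (k • a.1) x = fun y => k • localRep a.1 x y := rfl
    have h2 : extDeriv (localRep (k • a.1) x) (extChartAt (𝓡 n) x x) =
        k • extDeriv (localRep a.1 x) (extChartAt (𝓡 n) x x) := by
      rw [h, extDeriv, extDeriv, fderiv_fun_const_smul hd]
      ext v
      simp [ContinuousAlternatingMap.alternatizeUncurryFin_apply, Finset.mul_sum]
    rw [extDerivAt, h2]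
    rfl

end Forms

/-! ### Riemannian manifolds: orientation, volume, codifferential -/

section Riemannian

variable {n : ℕ} {𝕜 : Type*} [RCLike 𝕜]
variable {M : Type*} [TopologicalSpace M] [ChartedSpace (EuclideanSpace ℝ (Fin n)) M]

instance fact_finrank_tangentSpace (x : M) : Fact (finrank ℝ (TangentSpace (𝓡 n) x) = n) :=
  ⟨finrank_euclideanSpace_fin (𝕜 := ℝ) (n := n)⟩

instance finiteDimensional_tangentSpace (x : M) :
    FiniteDimensional ℝ (TangentSpace (𝓡 n) x) :=
  inferInstanceAs (FiniteDimensional ℝ (EuclideanSpace ℝ (Fin n)))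

variable (n M) in
/-- An orientation of the manifold `M`: an orientation of every tangent space that, read in the
chart around any point `c`, is constant near `c`. -/
structure ManifoldOrientation where
  /-- the orientation of the tangent space at a point -/
  at_ : ∀ x : M, Orientation ℝ (TangentSpace (𝓡 n) x) (Fin n)
  locally_constant : ∀ c : M, ∃ o : Orientation ℝ (EuclideanSpace ℝ (Fin n)) (Fin n),
    ∀ᶠ x in 𝓝 c, ∃ L : TangentSpace (𝓡 n) x ≃ₗ[ℝ] EuclideanSpace ℝ (Fin n),
      (∀ v, L v = mfderiv (𝓡 n) 𝓘(ℝ, EuclideanSpace ℝ (Fin n)) (extChartAt (𝓡 n) c) x v) ∧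
      Orientation.map (Fin n) L (at_ x) = o

variable [RiemannianBundle (fun x : M => TangentSpace (𝓡 n) x)]

/-- The Gram matrix `g_{ij}(y) = g(∂_i, ∂_j)` of the metric in the chart around `c`. -/
def gram (c : M) (y : EuclideanSpace ℝ (Fin n)) : Matrix (Fin n) (Fin n) ℝ :=
  fun i j => inner ℝ
    (mfderiv 𝓘(ℝ, EuclideanSpace ℝ (Fin n)) (𝓡 n) (extChartAt (𝓡 n) c).symm y
      (EuclideanSpace.single i (1 : ℝ)) : TangentSpace (𝓡 n) ((extChartAt (𝓡 n) c).symm y))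
    (mfderiv 𝓘(ℝ, EuclideanSpace ℝ (Fin n)) (𝓡 n) (extChartAt (𝓡 n) c).symm y
      (EuclideanSpace.single j (1 : ℝ)) : TangentSpace (𝓡 n) ((extChartAt (𝓡 n) c).symm y))

variable [MeasurableSpace M]

/-- The measure `√(det g_{ij}) dy¹ ⋯ dyⁿ` on the domain of the chart around `c`, extended by zero
to `M`. -/
def chartVolume (c : M) : Measure M :=
  ((volume.restrict (extChartAt (𝓡 n) c).target).withDensity
    (fun y => ENNReal.ofReal (Real.sqrt (gram c y).det))).map (extChartAt (𝓡 n) c).symm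

variable (n M) in
/-- The Riemannian volume measure. The chart measures agree where the chart domains overlap, and
their supremum in the lattice of measures is the measure on `M` glued from them. -/
def riemannianVolume : Measure M := ⨆ c : M, chartVolume (n := n) c

/-- The `L²` product `(θ, η) = ∫_M ⟨θ, η⟩ dvol`. -/
def l2Inner {p : ℕ} (θ η : SmoothForm n 𝕜 M p) : 𝕜 :=
  ∫ x, formInner (θ.1 x) (η.1 x) ∂(riemannianVolume n M)

variable [IsManifold (𝓡 n) ∞ M]

/-- `δ : Ωᵖ⁺¹ → Ωᵖ` is a formal adjoint of `d : Ωᵖ → Ωᵖ⁺¹`: `(dθ, η) = (θ, δη)` for all `η` and all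
compactly supported `θ`. There is at most one such `δ`. -/
def IsFormalAdjoint {p : ℕ} (δ : SmoothForm n 𝕜 M (p + 1) →ₗ[𝕜] SmoothForm n 𝕜 M p) : Prop :=
  ∀ (θ : SmoothForm n 𝕜 M p) (η : SmoothForm n 𝕜 M (p + 1)), HasCompactSupp θ →
    l2Inner (extD n 𝕜 M p θ) η = l2Inner θ (δ η)

variable (n 𝕜 M) in
open Classical in
/-- The codifferential `δ : Ωᵖ⁺¹(M, 𝕜) → Ωᵖ(M, 𝕜)`, the formal adjoint of `d`. -/
def codiff (p : ℕ) : SmoothForm n 𝕜 M (p + 1) →ₗ[𝕜] SmoothForm n 𝕜 M p :=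
  if h : ∃ δ : SmoothForm n 𝕜 M (p + 1) →ₗ[𝕜] SmoothForm n 𝕜 M p, IsFormalAdjoint δ
  then h.choose else 0

variable (n 𝕜 M) in
/-- The generalized Hodge-Laplace operator `F_{αβ,p} = α d δ + β δ d` on `Ωᵖ(M, 𝕜)`; for `p = 0`
the first summand vanishes. -/
def genHodge (α β : ℝ) : (p : ℕ) → SmoothForm n 𝕜 M p →ₗ[𝕜] SmoothForm n 𝕜 M p
  | 0 => (β : 𝕜) • (codiff n 𝕜 M 0 ∘ₗ extD n 𝕜 M 0)
  | p + 1 => (α : 𝕜) • (extD n 𝕜 M p ∘ₗ codiff n 𝕜 M p) +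
      (β : 𝕜) • (codiff n 𝕜 M (p + 1) ∘ₗ extD n 𝕜 M (p + 1))

variable (n 𝕜 M) in
/-- The spectrum of `F_{αβ,p}` as a weighted set: it assigns to `l` the dimension of the eigenspace
`{θ ∈ Ωᵖ(M, 𝕜) | F_{αβ,p} θ = l θ}`. The dimension is a cardinal number, so that the definition
is meaningful also where an eigenspace has infinite dimension (which needs `M` non-compact). -/
def spec (α β : ℝ) (p : ℕ) (l : 𝕜) : Cardinal :=
  Module.rank 𝕜 (Module.End.eigenspace (M := SmoothForm n 𝕜 M p) (genHodge n 𝕜 M α β p) l)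

end Riemannian

end

end GenHodge

/-!
The Hodge star is characterised by `a ∧ ⋆b̄ = ⟨a, b⟩ vol` (`wedgeSum_hodgeStar`) and satisfies
`⋆⋆ = (-1)^{pq}` from degree `p` to degree `q = n - p` and back (`hodgeStar_hodgeStar`), both checked
on an orthonormal basis. In a chart its components are polynomial in the inverse Gram matrix,
`√(det g)` and the components of the form (`hodgeStar_eq_sum_gram`), with a sign that is locally
constant because the orientation is (`exists_sign_volumeForm`). Hence it preserves smoothness and is
an isomorphism `Ωᵖ ≃ Ω^{n-p}` (`starFun_mem`, `starEquiv`).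

The heart of the matter is that `(-1)^{p+1} ⋆⁻¹ d ⋆` is the formal adjoint of `d`
(`isFormalAdjoint_starCodiff`). By the change of variables formula the chart measures
`√(det g) dy` agree on overlaps, so that the Riemannian volume, a supremum of measures, restricts to
each of them (`riemannianVolume_restrict_source`). For a form `θ` with compact support in a chart,
`(dθ, η)` and `(θ, ⋆⁻¹ d ⋆ η)` are therefore integrals over `ℝⁿ` of `dθ ∧ ⋆η̄` and `θ ∧ d⋆η̄`, and an
integration by parts relates them (`integral_wedgeSum_extDeriv`, `l2Inner_extD_of_subset`); a
partition of unity reduces the general case to this one. The formal adjoint is unique, since pairing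
`ξ = δη - δ'η` with a bump function times `ξ` shows that `ξ` vanishes (`isFormalAdjoint_unique`).
So `δ = (-1)^{p+1} ⋆⁻¹ d ⋆` in every degree up to `n`; above it all forms are zero.

Combined with `⋆⋆ = (-1)^{pq}`, this formula gives `⋆ δ d = d δ ⋆` and `⋆ d δ = δ d ⋆`
(`starMap_codiff_extD`, `starMap_extD_codiff`): conjugation by `⋆` interchanges the two summands of
`α d δ + β δ d`. The star then maps eigenspaces isomorphically onto eigenspaces, and the spectra
agree.
-/

namespace GenHodge

noncomputable section

/-! ### Splitting `Fin n` into a left block of size `p` and a right block of size `q` -/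

section Blocks

variable {n p q : ℕ}

/-- The inclusion of the first `p` indices. -/
def leftIdx (h : p + q = n) (i : Fin p) : Fin n := Fin.cast h (Fin.castAdd q i)

/-- The inclusion of the last `q` indices. -/
def rightIdx (h : p + q = n) (j : Fin q) : Fin n := Fin.cast h (Fin.natAdd p j)

/-- The concatenation of a `p`-tuple and a `q`-tuple. -/
def join {X : Type*} (h : p + q = n) (u : Fin p → X) (v : Fin q → X) (k : Fin n) : X :=
  Fin.append u v (Fin.cast h.symm k)

theorem leftIdx_or_rightIdx (h : p + q = n) (k : Fin n) :
    (∃ i, k = leftIdx h i) ∨ ∃ j, k = rightIdx h j := by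
  subst h
  refine Fin.addCases (fun i => Or.inl ⟨i, rfl⟩) (fun j => Or.inr ⟨j, rfl⟩) k

theorem leftIdx_injective (h : p + q = n) : Function.Injective (leftIdx h) := by
  intro i j hij
  simpa [leftIdx] using hij

theorem rightIdx_injective (h : p + q = n) : Function.Injective (rightIdx h) := by
  intro i j hij
  simpa [rightIdx] using hij

theorem leftIdx_ne_rightIdx (h : p + q = n) (i : Fin p) (j : Fin q) :
    leftIdx h i ≠ rightIdx h j := by
  intro hij
  have := congrArg Fin.val hij
  simp [leftIdx, rightIdx] at this
  omega

@[simp]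
theorem join_leftIdx {X : Type*} (h : p + q = n) (u : Fin p → X) (v : Fin q → X) (i : Fin p) :
    join h u v (leftIdx h i) = u i := by
  simp [join, leftIdx]

@[simp]
theorem join_rightIdx {X : Type*} (h : p + q = n) (u : Fin p → X) (v : Fin q → X) (j : Fin q) :
    join h u v (rightIdx h j) = v j := by
  simp [join, rightIdx]

theorem eq_join {X : Type*} (h : p + q = n) {u : Fin p → X} {v : Fin q → X} {w : Fin n → X}
    (hu : ∀ i, w (leftIdx h i) = u i) (hv : ∀ j, w (rightIdx h j) = v j) : w = join h u v := by
  funext k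
  rcases leftIdx_or_rightIdx h k with ⟨i, rfl⟩ | ⟨j, rfl⟩
  · simp [hu]
  · simp [hv]

theorem comp_join {X Y : Type*} (h : p + q = n) (e : X → Y) (u : Fin p → X) (v : Fin q → X) :
    e ∘ join h u v = join h (e ∘ u) (e ∘ v) :=
  eq_join h (fun i => by simp) (fun j => by simp)

/-- The permutation of `Fin n` that acts as `τ` on the left block. -/
def leftPerm (h : p + q = n) (τ : Equiv.Perm (Fin p)) : Equiv.Perm (Fin n) :=
  (finSumFinEquiv.trans (finCongr h)).permCongr (Equiv.sumCongr τ 1)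

theorem sign_leftPerm (h : p + q = n) (τ : Equiv.Perm (Fin p)) :
    Equiv.Perm.sign (leftPerm h τ) = Equiv.Perm.sign τ := by
  rw [leftPerm, Equiv.Perm.sign_permCongr]
  exact (Equiv.Perm.sign_sumCongr τ 1).trans (by simp)

@[simp]
theorem leftPerm_leftIdx (h : p + q = n) (τ : Equiv.Perm (Fin p)) (i : Fin p) :
    leftPerm h τ (leftIdx h i) = leftIdx h (τ i) := by
  subst h
  simp [leftPerm, leftIdx, Equiv.permCongr_apply]

@[simp]
theorem leftPerm_rightIdx (h : p + q = n) (τ : Equiv.Perm (Fin p)) (j : Fin q) :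
    leftPerm h τ (rightIdx h j) = rightIdx h j := by
  subst h
  simp [leftPerm, rightIdx, Equiv.permCongr_apply]

/-- The block transposition, moving the right block of `q + p = n` to the left block of
`p + q = n`. -/
def swapBlocks (h : p + q = n) (h' : q + p = n) : Equiv.Perm (Fin n) :=
  (finCongr h.symm).trans (finAddFlip.trans (finCongr h'))

@[simp]
theorem swapBlocks_leftIdx (h : p + q = n) (h' : q + p = n) (i : Fin p) :
    swapBlocks h h' (leftIdx h i) = rightIdx h' i := by
  subst h
  simp [swapBlocks, leftIdx, rightIdx]

@[simp]
theorem swapBlocks_rightIdx (h : p + q = n) (h' : q + p = n) (j : Fin q) :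
    swapBlocks h h' (rightIdx h j) = leftIdx h' j := by
  subst h
  simp [swapBlocks, leftIdx, rightIdx]

theorem sign_swapBlocks (h : p + q = n) (h' : q + p = n) :
    Equiv.Perm.sign (swapBlocks h h') = (-1) ^ (p * q) := by
  rcases Nat.eq_zero_or_pos n with hn | hn
  · have hp : p = 0 := by omega
    subst hn
    rw [Subsingleton.elim (swapBlocks h h') 1]
    simp [hp]
  obtain ⟨m, rfl⟩ : ∃ m, n = m + 1 := ⟨n - 1, by omega⟩
  -- the block transposition is the cyclic shift by `q`
  have hpow : ∀ (k : ℕ) (i : Fin (m + 1)),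
      (((finRotate (m + 1)) ^ k) i : ℕ) = (i + k) % (m + 1) := by
    intro k i
    induction k with
    | zero => simp [Nat.mod_eq_of_lt i.isLt]
    | succ k ih =>
      rw [pow_succ', Equiv.Perm.mul_apply, finRotate_apply, Fin.val_add, ih]
      simp [← add_assoc]
  have hs : swapBlocks h h' = finRotate (m + 1) ^ q := by
    ext k
    rw [hpow]
    rcases leftIdx_or_rightIdx h k with ⟨i, rfl⟩ | ⟨j, rfl⟩
    · rw [swapBlocks_leftIdx]
      simp only [rightIdx, leftIdx, Fin.val_cast, Fin.val_natAdd, Fin.val_castAdd]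
      rw [Nat.mod_eq_of_lt (by omega)]; omega
    · rw [swapBlocks_rightIdx]
      simp only [rightIdx, leftIdx, Fin.val_cast, Fin.val_natAdd, Fin.val_castAdd]
      rw [show p + (j : ℕ) + q = j + (m + 1) by omega, Nat.add_mod_right,
        Nat.mod_eq_of_lt (by omega)]
  rw [hs, map_pow, sign_finRotate, ← pow_mul, Nat.add_sub_cancel]
  rcases Nat.even_or_odd q with hq | hq
  · rw [Even.neg_one_pow (hq.mul_left m), Even.neg_one_pow (hq.mul_left p)]
  · rw [mul_comm, pow_mul, mul_comm p q, pow_mul, hq.neg_one_pow]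
    have : m + p = 2 * p + 2 * (q / 2) := by
      have := Nat.div_add_mod q 2
      rw [Nat.odd_iff.1 hq] at this
      omega
    have h1 : ((-1 : ℤˣ)) ^ m * (-1) ^ p = 1 := by
      rw [← pow_add, this, ← mul_add, pow_mul]; simp
    rcases Nat.even_or_odd p with h2 | h2 <;> simpa [h2.neg_one_pow, neg_eq_iff_eq_neg] using h1

/-- The permutation of `Fin n` that acts as `τ` on the right block. -/
def rightPerm (h : p + q = n) (τ : Equiv.Perm (Fin q)) : Equiv.Perm (Fin n) :=
  (finSumFinEquiv.trans (finCongr h)).permCongr (Equiv.sumCongr 1 τ)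

theorem sign_rightPerm (h : p + q = n) (τ : Equiv.Perm (Fin q)) :
    Equiv.Perm.sign (rightPerm h τ) = Equiv.Perm.sign τ := by
  rw [rightPerm, Equiv.Perm.sign_permCongr]
  exact (Equiv.Perm.sign_sumCongr 1 τ).trans (by simp)

@[simp]
theorem rightPerm_leftIdx (h : p + q = n) (τ : Equiv.Perm (Fin q)) (i : Fin p) :
    rightPerm h τ (leftIdx h i) = leftIdx h i := by
  subst h
  simp [rightPerm, leftIdx, Equiv.permCongr_apply]

@[simp]
theorem rightPerm_rightIdx (h : p + q = n) (τ : Equiv.Perm (Fin q)) (j : Fin q) :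
    rightPerm h τ (rightIdx h j) = rightIdx h (τ j) := by
  subst h
  simp [rightPerm, rightIdx, Equiv.permCongr_apply]

/-- Each injective `f` is the left block of exactly `q!` permutations. -/
theorem sum_perm_leftIdx {A : Type*} [AddCommMonoid A] (h : p + q = n) (F : (Fin p → Fin n) → A)
    (hF : ∀ f, ¬ Function.Injective f → F f = 0) :
    ∑ σ : Equiv.Perm (Fin n), F (σ ∘ leftIdx h) = q.factorial • ∑ f, F f := by
  classical
  rw [← Finset.sum_fiberwise (s := Finset.univ) (g := fun σ : Equiv.Perm (Fin n) => ⇑σ ∘ leftIdx h),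
    Finset.smul_sum]
  refine Finset.sum_congr rfl fun f _ => ?_
  by_cases hf : Function.Injective f
  · rw [Finset.sum_congr rfl (g := fun _ => F f)
      (fun σ hσ => by rw [(Finset.mem_filter.1 hσ).2]), Finset.sum_const]
    congr 1
    obtain ⟨ρ, hρ⟩ : ∃ ρ : Equiv.Perm (Fin n), ρ ∘ leftIdx h = f := by
      obtain ⟨ρ, hρ⟩ := Equiv.Perm.exists_extending_pair (leftIdx h) f (leftIdx_injective h) hf
      exact ⟨ρ, funext fun i => hρ i⟩
    have hcard : (Finset.univ : Finset (Equiv.Perm (Fin q))).card = q.factorial := by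
      rw [Finset.card_univ, Fintype.card_perm, Fintype.card_fin]
    rw [← hcard]
    symm
    -- one extension `ρ` of `f` gives all of them, by permuting the right block first
    refine Finset.card_bij (fun τ _ => ρ * rightPerm h τ) ?_ ?_ ?_
    · intro τ _
      simp only [Finset.mem_filter, Finset.mem_univ, true_and, ← hρ]
      funext i
      simp
    · intro τ _ τ' _ hτ
      ext j
      have := congrArg (fun ρ : Equiv.Perm (Fin n) => ρ (rightIdx h j)) (mul_left_cancel hτ)
      exact congrArg Fin.val (rightIdx_injective h (by simpa using this))
    · intro σ hσ
      have hσ' : ∀ i, σ (leftIdx h i) = ρ (leftIdx h i) := fun i =>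
        congrFun ((Finset.mem_filter.1 hσ).2.trans hρ.symm) i
      have hex : ∀ j, ∃ j', ρ.symm (σ (rightIdx h j)) = rightIdx h j' := by
        intro j
        rcases leftIdx_or_rightIdx h (ρ.symm (σ (rightIdx h j))) with ⟨i, hi⟩ | hj
        · exfalso
          rw [Equiv.symm_apply_eq, ← hσ'] at hi
          exact leftIdx_ne_rightIdx h i j (σ.injective hi).symm
        · exact hj
      choose τ hτ using hex
      have hτi : Function.Injective τ := fun i j hij => by
        have := (hτ i).trans ((congrArg (rightIdx h) hij).trans (hτ j).symm)
        exact rightIdx_injective h (σ.injective (ρ.symm.injective this))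
      refine ⟨Equiv.ofBijective τ (Finite.injective_iff_bijective.1 hτi), Finset.mem_univ _, ?_⟩
      refine Equiv.ext fun k => ?_
      rcases leftIdx_or_rightIdx h k with ⟨i, rfl⟩ | ⟨j, rfl⟩
      · simp [hσ']
      · simp [← hτ]
  · rw [hF f hf, smul_zero]
    exact Finset.sum_eq_zero fun σ hσ => by rw [(Finset.mem_filter.1 hσ).2, hF f hf]

end Blocks

/-! ### The Hodge star of one oriented Euclidean vector space -/

section Pointwise

variable {𝕜 : Type*} [RCLike 𝕜]
variable {V : Type*} [NormedAddCommGroup V] [InnerProductSpace ℝ V] [FiniteDimensional ℝ V]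
variable {n p q : ℕ}

theorem alternating_comp_perm {W : Type*} [AddCommGroup W] [Module ℝ W] [TopologicalSpace W]
    (b : W [⋀^Fin p]→L[ℝ] 𝕜) (v : Fin p → W) (τ : Equiv.Perm (Fin p)) :
    b (v ∘ τ) = ((Equiv.Perm.sign τ : ℤ) : 𝕜) * b v := by
  have := b.toAlternatingMap.map_perm v τ
  simpa [Units.smul_def, zsmul_eq_mul] using this

theorem volume_comp_perm {W : Type*} [AddCommGroup W] [Module ℝ W]
    (ν : W [⋀^Fin n]→ₗ[ℝ] ℝ) (v : Fin n → W) (τ : Equiv.Perm (Fin n)) :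
    ν (v ∘ τ) = ((Equiv.Perm.sign τ : ℤ) : ℝ) * ν v := by
  have := ν.map_perm v τ
  simpa [Units.smul_def, zsmul_eq_mul] using this

/-- Contracting an alternating map with a top form over a family of vectors: only the `p!` orderings
of the block complementary to the fixed one contribute, and equally. -/
theorem sum_contract {W : Type*} [AddCommGroup W] [Module ℝ W] [TopologicalSpace W]
    (h : p + q = n) (ν : W [⋀^Fin n]→ₗ[ℝ] ℝ)
    (b : W [⋀^Fin p]→L[ℝ] 𝕜) (e : Fin n → W) (σ : Equiv.Perm (Fin n)) :
    ∑ f : Fin p → Fin n, b (e ∘ f) * ((ν (join h (e ∘ f) (e ∘ σ ∘ rightIdx h)) : ℝ) : 𝕜) =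
      (p.factorial : 𝕜) * (((Equiv.Perm.sign σ : ℤ) : 𝕜) * ((ν e : ℝ) : 𝕜) *
        b (e ∘ σ ∘ leftIdx h)) := by
  classical
  have key : ∀ τ : Equiv.Perm (Fin p), ((Equiv.Perm.sign σ : ℤ) : 𝕜) * ((ν e : ℝ) : 𝕜) *
        b (e ∘ σ ∘ leftIdx h) = b (e ∘ (σ ∘ leftIdx h ∘ τ)) *
          ((ν (join h (e ∘ (σ ∘ leftIdx h ∘ τ)) (e ∘ σ ∘ rightIdx h)) : ℝ) : 𝕜) := by
    intro τ
    -- both factors change by the sign of `τ`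
    have h1 : join h (e ∘ (σ ∘ leftIdx h ∘ τ)) (e ∘ σ ∘ rightIdx h) =
        (e ∘ σ) ∘ leftPerm h τ :=
      (eq_join h (fun i => by simp) (fun j => by simp)).symm
    have h2 : e ∘ (σ ∘ leftIdx h ∘ τ) = (e ∘ σ ∘ leftIdx h) ∘ τ := rfl
    rw [h1, volume_comp_perm, volume_comp_perm, h2, alternating_comp_perm, sign_leftPerm]
    rcases Int.units_eq_one_or (Equiv.Perm.sign τ) with h3 | h3 <;> rw [h3] <;> push_cast <;> ring
  rw [← Fintype.sum_of_injective (fun τ : Equiv.Perm (Fin p) => (σ ∘ leftIdx h ∘ τ))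
    (f := fun _ => ((Equiv.Perm.sign σ : ℤ) : 𝕜) * ((ν e : ℝ) : 𝕜) * b (e ∘ σ ∘ leftIdx h))]
  · simp [Finset.card_univ, Fintype.card_perm]
  · intro τ τ' hτ
    ext i
    have := leftIdx_injective h (σ.injective (congrFun hτ i))
    exact congrArg Fin.val this
  · -- any other `f` repeats an index, in itself or in the right block, and contributes zero
    intro f hf
    have hni : ¬ Function.Injective (join h f (σ ∘ rightIdx h)) := by
      intro hinj
      apply hf
      have hfi : Function.Injective f := fun i j hij =>
        leftIdx_injective h (hinj (by simpa using hij))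
      have hex : ∀ i, ∃ j, f i = σ (leftIdx h j) := by
        intro i
        rcases leftIdx_or_rightIdx h (σ.symm (f i)) with ⟨j, hj⟩ | ⟨j, hj⟩
        · exact ⟨j, by rw [← hj, σ.apply_symm_apply]⟩
        · exfalso
          refine leftIdx_ne_rightIdx h i j (hinj ?_)
          rw [join_leftIdx, join_rightIdx, Function.comp_apply, ← hj, σ.apply_symm_apply]
      choose τ hτ using hex
      have hτi : Function.Injective τ := fun i j hij => hfi (by rw [hτ, hτ, hij])
      refine ⟨Equiv.ofBijective τ (Finite.injective_iff_bijective.1 hτi), ?_⟩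
      funext i
      simp [hτ]
    have : ν (join h (e ∘ f) (e ∘ σ ∘ rightIdx h)) = 0 := by
      rw [← comp_join h e f (σ ∘ rightIdx h)]
      exact ν.map_eq_zero_of_not_injective _ fun hh => hni hh.of_comp
    rw [this]; simp
  · exact key

variable (V n) in
/-- The standard orthonormal basis, indexed by `Fin n`. -/
def onb [hn : Fact (finrank ℝ V = n)] : OrthonormalBasis (Fin n) ℝ V :=
  (stdOrthonormalBasis ℝ V).reindex (finCongr hn.out)

theorem formInner_eq_sum_onb [hn : Fact (finrank ℝ V = n)] (θ η : V [⋀^Fin p]→L[ℝ] 𝕜) :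
    formInner θ η = ((p.factorial : ℕ) : 𝕜)⁻¹ * ∑ f : Fin p → Fin n,
      θ (onb V n ∘ f) * (starRingEnd 𝕜) (η (onb V n ∘ f)) := by
  have := hn.out
  subst this
  rfl

variable [Fact (finrank ℝ V = n)] (o : Orientation ℝ V (Fin n))

theorem hodgeStar_eq_sum_onb (h : p + q = n) (η : V [⋀^Fin p]→L[ℝ] 𝕜) (v : Fin q → V) :
    hodgeStar o h η v = ((p.factorial : ℕ) : 𝕜)⁻¹ * ∑ f : Fin p → Fin n,
      η (onb V n ∘ f) * ((o.volumeForm (join h (onb V n ∘ f) v) : ℝ) : 𝕜) := by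
  have hn : finrank ℝ V = n := Fact.out
  subst hn
  rfl

/-- On the orthonormal basis, the components of `⋆η` are those of `η` for the complementary indices,
up to sign. The factor `vol(e₁, …, eₙ) = ±1` compares the basis with the orientation. -/
theorem hodgeStar_onb_perm (h : p + q = n) (η : V [⋀^Fin p]→L[ℝ] 𝕜) (σ : Equiv.Perm (Fin n)) :
    hodgeStar o h η (onb V n ∘ σ ∘ rightIdx h) =
      ((Equiv.Perm.sign σ : ℤ) : 𝕜) * ((o.volumeForm (onb V n) : ℝ) : 𝕜) *
        η (onb V n ∘ σ ∘ leftIdx h) := by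
  rw [hodgeStar_eq_sum_onb, sum_contract, ← mul_assoc, inv_mul_cancel₀, one_mul]
  exact_mod_cast p.factorial_ne_zero

theorem volumeForm_onb_mul_self : o.volumeForm (onb V n) * o.volumeForm (onb V n) = 1 := by
  have := o.abs_volumeForm_apply_of_orthonormal (onb V n)
  rw [← abs_mul_abs_self, this, one_mul]

theorem hodgeStar_hodgeStar (h : p + q = n) (h' : q + p = n) (η : V [⋀^Fin p]→L[ℝ] 𝕜) :
    hodgeStar o h' (hodgeStar o h η) = ((-1 : 𝕜) ^ (p * q)) • η := by
  refine ContinuousAlternatingMap.toAlternatingMap_injective ?_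
  refine Basis.ext_alternating (onb V n).toBasis fun f hf => ?_
  obtain ⟨ρ, hρ⟩ := Equiv.Perm.exists_extending_pair (leftIdx h) f (leftIdx_injective h) hf
  have e1 : (fun i => (onb V n).toBasis (f i)) =
      onb V n ∘ ⇑(ρ * swapBlocks h' h) ∘ rightIdx h' := by
    funext i
    simp [hρ]
  have e2 : onb V n ∘ ⇑(ρ * swapBlocks h' h) ∘ leftIdx h' = onb V n ∘ ρ ∘ rightIdx h := by
    funext i
    simp
  have e3 : onb V n ∘ ⇑(ρ * swapBlocks h' h) ∘ rightIdx h' = onb V n ∘ ρ ∘ leftIdx h := by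
    funext i
    simp
  change hodgeStar o h' (hodgeStar o h η) _ = ((-1 : 𝕜) ^ (p * q)) * η _
  rw [e1, hodgeStar_onb_perm, e2, hodgeStar_onb_perm, e3, map_mul, sign_swapBlocks, mul_comm q p]
  have hv : ((o.volumeForm (onb V n) : ℝ) : 𝕜) * ((o.volumeForm (onb V n) : ℝ) : 𝕜) = 1 := by
    rw [← RCLike.ofReal_mul, volumeForm_onb_mul_self, RCLike.ofReal_one]
  have hs : (((Equiv.Perm.sign ρ : ℤˣ) : ℤ) : 𝕜) * (((Equiv.Perm.sign ρ : ℤˣ) : ℤ) : 𝕜) = 1 := by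
    rcases Int.units_eq_one_or (Equiv.Perm.sign ρ) with h3 | h3 <;> simp [h3]
  push_cast
  linear_combination ((-1 : 𝕜) ^ (p * q)) * η (onb V n ∘ ρ ∘ leftIdx h) *
    ((((Equiv.Perm.sign ρ : ℤˣ) : ℤ) : 𝕜) * (((Equiv.Perm.sign ρ : ℤˣ) : ℤ) : 𝕜) * hv + hs)

/-- `p! q!` times the value of `a ∧ b̄` on `n` vectors, as a signed sum over all permutations. -/
def wedgeSum {W : Type*} [AddCommGroup W] [Module ℝ W] [TopologicalSpace W] (h : p + q = n)
    (a : W [⋀^Fin p]→L[ℝ] 𝕜) (b : W [⋀^Fin q]→L[ℝ] 𝕜) (v : Fin n → W) : 𝕜 :=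
  ∑ σ : Equiv.Perm (Fin n), ((Equiv.Perm.sign σ : ℤ) : 𝕜) *
    (a (v ∘ σ ∘ leftIdx h) * (starRingEnd 𝕜) (b (v ∘ σ ∘ rightIdx h)))

theorem exists_alternating_wedgeSum {W : Type*} [AddCommGroup W] [Module ℝ W] [TopologicalSpace W]
    (h : p + q = n) (a : W [⋀^Fin p]→L[ℝ] 𝕜) (b : W [⋀^Fin q]→L[ℝ] 𝕜) :
    ∃ Φ : W [⋀^Fin n]→ₗ[ℝ] 𝕜, ∀ v, Φ v = wedgeSum h a b v := by
  have hL : ∀ (inst : DecidableEq (Fin n)) (v : Fin n → W) (i : Fin p) (x : W),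
      Function.update v (leftIdx h i) x ∘ leftIdx h = Function.update (v ∘ leftIdx h) i x := by
    intro inst v i x
    obtain rfl := Subsingleton.elim inst (instDecidableEqFin n)
    exact Function.update_comp_eq_of_injective v (leftIdx_injective h) i x
  have hR : ∀ (inst : DecidableEq (Fin n)) (v : Fin n → W) (i : Fin q) (x : W),
      Function.update v (rightIdx h i) x ∘ rightIdx h = Function.update (v ∘ rightIdx h) i x := by
    intro inst v i x
    obtain rfl := Subsingleton.elim inst (instDecidableEqFin n)
    exact Function.update_comp_eq_of_injective v (rightIdx_injective h) i x
  have hLR : ∀ (inst : DecidableEq (Fin n)) (v : Fin n → W) (i : Fin p) (x : W),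
      Function.update v (leftIdx h i) x ∘ rightIdx h = v ∘ rightIdx h := by
    intro inst v i x
    funext j
    exact Function.update_of_ne (leftIdx_ne_rightIdx h i j).symm _ _
  have hRL : ∀ (inst : DecidableEq (Fin n)) (v : Fin n → W) (i : Fin q) (x : W),
      Function.update v (rightIdx h i) x ∘ leftIdx h = v ∘ leftIdx h := by
    intro inst v i x
    funext j
    exact Function.update_of_ne (leftIdx_ne_rightIdx h j i) _ _
  let m : MultilinearMap ℝ (fun _ : Fin n => W) 𝕜 :=
    { toFun := fun v => a (v ∘ leftIdx h) * (starRingEnd 𝕜) (b (v ∘ rightIdx h))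
      map_update_add' := by
        intro inst v k x y
        rcases leftIdx_or_rightIdx h k with ⟨i, rfl⟩ | ⟨j, rfl⟩
        · simp only [hL, hLR, a.map_update_add, add_mul]
        · simp only [hR, hRL, b.map_update_add, map_add, mul_add]
      map_update_smul' := by
        intro inst v k c x
        rcases leftIdx_or_rightIdx h k with ⟨i, rfl⟩ | ⟨j, rfl⟩
        · simp only [hL, hLR, a.map_update_smul, smul_mul_assoc]
        · simp only [hR, hRL, b.map_update_smul]
          rw [RCLike.real_smul_eq_coe_mul, map_mul, RCLike.conj_ofReal,
            ← RCLike.real_smul_eq_coe_mul, mul_smul_comm] }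
  refine ⟨MultilinearMap.alternatization m, fun v => ?_⟩
  rw [MultilinearMap.alternatization_apply, wedgeSum]
  refine Finset.sum_congr rfl fun σ _ => ?_
  rw [Units.smul_def, zsmul_eq_mul]
  rfl

/-- The defining property `a ∧ ⋆b̄ = ⟨a, b⟩ vol` of the Hodge star. Both sides are alternating, so
it suffices to compare them on the orthonormal basis. -/
theorem wedgeSum_hodgeStar (h : p + q = n) (a b : V [⋀^Fin p]→L[ℝ] 𝕜) (v : Fin n → V) :
    wedgeSum h a (hodgeStar o h b) v =
      (p.factorial : 𝕜) * q.factorial * formInner a b * ((o.volumeForm v : ℝ) : 𝕜) := by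
  obtain ⟨Φ, hΦ⟩ := exists_alternating_wedgeSum h a (hodgeStar o h b)
  let Φ' : V [⋀^Fin n]→ₗ[ℝ] 𝕜 := (LinearMap.mulLeft ℝ
    ((p.factorial : 𝕜) * q.factorial * formInner a b) ∘ₗ
      (RCLike.ofRealAm (K := 𝕜)).toLinearMap).compAlternatingMap o.volumeForm
  have hΦ' : ∀ v, Φ' v =
      (p.factorial : 𝕜) * q.factorial * formInner a b * ((o.volumeForm v : ℝ) : 𝕜) := fun v => rfl
  rw [← hΦ, ← hΦ']
  congr 1
  have hbase : Φ (onb V n) = Φ' (onb V n) := by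
    rw [hΦ, hΦ', formInner_eq_sum_onb (n := n), wedgeSum]
    have hterm : ∀ σ : Equiv.Perm (Fin n), ((Equiv.Perm.sign σ : ℤ) : 𝕜) *
        (a (onb V n ∘ σ ∘ leftIdx h) *
          (starRingEnd 𝕜) (hodgeStar o h b (onb V n ∘ σ ∘ rightIdx h))) =
        ((o.volumeForm (onb V n) : ℝ) : 𝕜) * (a (onb V n ∘ (σ ∘ leftIdx h)) *
          (starRingEnd 𝕜) (b (onb V n ∘ (σ ∘ leftIdx h)))) := by
      intro σ
      rw [hodgeStar_onb_perm, map_mul, map_mul, RCLike.conj_ofReal]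
      rcases Int.units_eq_one_or (Equiv.Perm.sign σ) with h3 | h3 <;> rw [h3] <;>
        simp only [Units.val_one, Units.val_neg, Int.cast_one, Int.cast_neg, map_one, map_neg] <;>
        ring
    rw [Finset.sum_congr rfl fun σ _ => hterm σ, ← Finset.mul_sum,
      sum_perm_leftIdx h (fun f => a (onb V n ∘ f) * (starRingEnd 𝕜) (b (onb V n ∘ f)))
      (fun f hf => by
        rw [a.map_eq_zero_of_not_injective (onb V n ∘ f) fun hh => hf hh.of_comp, zero_mul])]
    have hp : (p.factorial : 𝕜) ≠ 0 := by exact_mod_cast p.factorial_ne_zero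
    rw [nsmul_eq_mul]
    field_simp
  refine Basis.ext_alternating (onb V n).toBasis fun f hf => ?_
  have hσ : (fun i => (onb V n).toBasis (f i)) =
      (onb V n : Fin n → V) ∘ Equiv.ofBijective f (Finite.injective_iff_bijective.1 hf) := by
    funext i
    simp
  rw [hσ, Φ.map_perm, Φ'.map_perm, hbase]

end Pointwise

/-! ### Inner product, Gram matrix and Hodge star in an arbitrary basis -/

section Gram

variable {𝕜 : Type*} [RCLike 𝕜]
variable {V : Type*} [NormedAddCommGroup V] [InnerProductSpace ℝ V] [FiniteDimensional ℝ V]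
variable {n p q : ℕ} [Fact (finrank ℝ V = n)] (o : Orientation ℝ V (Fin n))

theorem hodgeStar_add (h : p + q = n) (θ η : V [⋀^Fin p]→L[ℝ] 𝕜) :
    hodgeStar o h (θ + η) = hodgeStar o h θ + hodgeStar o h η := by
  ext v
  rw [ContinuousAlternatingMap.add_apply, hodgeStar_eq_sum_onb, hodgeStar_eq_sum_onb,
    hodgeStar_eq_sum_onb, ← mul_add, ← Finset.sum_add_distrib]
  simp [add_mul]

theorem hodgeStar_smul (h : p + q = n) (c : 𝕜) (η : V [⋀^Fin p]→L[ℝ] 𝕜) :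
    hodgeStar o h (c • η) = c • hodgeStar o h η := by
  ext v
  rw [ContinuousAlternatingMap.smul_apply, hodgeStar_eq_sum_onb, hodgeStar_eq_sum_onb,
    smul_eq_mul, mul_left_comm, Finset.mul_sum]
  simp [mul_assoc, Finset.mul_sum]

theorem formInner_sub_right (θ η η' : V [⋀^Fin p]→L[ℝ] 𝕜) :
    formInner θ (η - η') = formInner θ η - formInner θ η' := by
  simp [formInner, mul_sub, Finset.sum_sub_distrib]

theorem formInner_add_left (θ θ' η : V [⋀^Fin p]→L[ℝ] 𝕜) :
    formInner (θ + θ') η = formInner θ η + formInner θ' η := by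
  simp [formInner, mul_add, add_mul, Finset.sum_add_distrib]

theorem formInner_sum_left {ι : Type*} (s : Finset ι) (θ : ι → V [⋀^Fin p]→L[ℝ] 𝕜)
    (η : V [⋀^Fin p]→L[ℝ] 𝕜) :
    formInner (∑ i ∈ s, θ i) η = ∑ i ∈ s, formInner (θ i) η := by
  classical
  induction s using Finset.induction_on with
  | empty => simp [formInner]
  | insert a s ha ih => rw [Finset.sum_insert ha, Finset.sum_insert ha, formInner_add_left, ih]

theorem formInner_smul_left (c : 𝕜) (θ η : V [⋀^Fin p]→L[ℝ] 𝕜) :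
    formInner (c • θ) η = c * formInner θ η := by
  simp only [formInner, ContinuousAlternatingMap.smul_apply, smul_eq_mul, mul_assoc,
    ← Finset.mul_sum]
  ring

theorem formInner_zero_left (η : V [⋀^Fin p]→L[ℝ] 𝕜) : formInner 0 η = 0 := by
  simp [formInner]

theorem formInner_zero_right (η : V [⋀^Fin p]→L[ℝ] 𝕜) : formInner η 0 = 0 := by
  simp [formInner]

theorem formInner_self (θ : V [⋀^Fin p]→L[ℝ] 𝕜) :
    formInner θ θ = ((((p.factorial : ℕ) : ℝ)⁻¹ * ∑ f : Fin p → Fin (finrank ℝ V),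
      ‖θ (fun i => stdOrthonormalBasis ℝ V (f i))‖ ^ 2 : ℝ) : 𝕜) := by
  rw [formInner]
  simp [RCLike.mul_conj]

theorem re_formInner_self_nonneg (θ : V [⋀^Fin p]→L[ℝ] 𝕜) :
    0 ≤ RCLike.re (formInner θ θ) := by
  rw [formInner_self, RCLike.ofReal_re]
  positivity

theorem eq_zero_of_formInner_self (θ : V [⋀^Fin p]→L[ℝ] 𝕜)
    (hθ : RCLike.re (formInner θ θ) = 0) : θ = 0 := by
  rw [formInner_self, RCLike.ofReal_re, mul_eq_zero, or_iff_right
    (by exact_mod_cast inv_ne_zero (Nat.cast_ne_zero.2 p.factorial_ne_zero)),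
    Finset.sum_eq_zero_iff_of_nonneg (fun _ _ => by positivity)] at hθ
  refine ContinuousAlternatingMap.toAlternatingMap_injective ?_
  refine Basis.ext_alternating (stdOrthonormalBasis ℝ V).toBasis fun f hf => ?_
  have := hθ f (Finset.mem_univ _)
  simpa using this

/-- The matrix of inner products of a family of vectors. -/
def gramMat (v : Fin n → V) : Matrix (Fin n) (Fin n) ℝ := fun i j => inner ℝ (v i) (v j)

theorem gramMat_eq_mul (v : Fin n → V) :
    gramMat v = ((onb V n).toBasis.toMatrix v).transpose * (onb V n).toBasis.toMatrix v := by
  ext i j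
  rw [Matrix.mul_apply, gramMat, ← (onb V n).sum_inner_mul_inner]
  refine Finset.sum_congr rfl fun k _ => ?_
  simp [Basis.toMatrix_apply, OrthonormalBasis.repr_apply_apply, real_inner_comm]

theorem det_gramMat (v : Fin n → V) : (gramMat v).det = o.volumeForm v ^ 2 := by
  rw [gramMat_eq_mul, Matrix.det_mul, Matrix.det_transpose, ← sq, ← sq_abs,
    ← sq_abs (o.volumeForm v), o.volumeForm_robust' (onb V n) v, Basis.det_apply]

theorem det_gramMat_pos (b : Basis (Fin n) ℝ V) : 0 < (gramMat b).det := by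
  have : IsUnit ((onb V n).toBasis.det b) := Basis.isUnit_det _ b
  rw [gramMat_eq_mul, Matrix.det_mul, Matrix.det_transpose, ← Basis.det_apply]
  exact mul_self_pos.2 this.ne_zero

theorem volumeForm_of_orientation_eq (b : Basis (Fin n) ℝ V) (hb : b.orientation = o) :
    o.volumeForm b = Real.sqrt (gramMat b).det := by
  rw [det_gramMat o, Real.sqrt_sq_eq_abs, eq_comm, abs_eq_self]
  by_cases ho : (onb V n).toBasis.orientation = o
  · rw [o.volumeForm_robust (onb V n) ho]
    exact ((Basis.orientation_eq_iff_det_pos _ _).1 (ho.trans hb.symm)).le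
  · rw [o.volumeForm_robust_neg (onb V n) ho, AlternatingMap.neg_apply, neg_nonneg]
    refine not_lt.1 fun hpos => ho ?_
    rw [← hb, Basis.orientation_eq_iff_det_pos]
    exact hpos

theorem volumeForm_of_orientation_ne (b : Basis (Fin n) ℝ V) (hb : b.orientation ≠ o) :
    o.volumeForm b = - Real.sqrt (gramMat b).det := by
  have h1 : b.orientation = -o := by
    rw [(b.orientation_ne_iff_eq_neg o).1 hb.symm]
    exact (neg_neg b.orientation).symm
  rw [← volumeForm_of_orientation_eq (-o) b h1, o.volumeForm_neg_orientation,
    AlternatingMap.neg_apply, neg_neg]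

/-- An alternating map in `n` variables with the last `q` variables fixed. -/
def fixRight {W : Type*} [AddCommGroup W] [Module ℝ W] (h : p + q = n)
    (ν : W [⋀^Fin n]→ₗ[ℝ] ℝ) (v : Fin q → W) : MultilinearMap ℝ (fun _ : Fin p => W) ℝ where
  toFun u := ν (join h u v)
  map_update_add' := by
    intro inst u i x y
    have key : ∀ x, join h (Function.update u i x) v =
        Function.update (join h u v) (leftIdx h i) x := by
      intro x
      refine (eq_join h (fun j => ?_) (fun j => ?_)).symm
      · by_cases hj : j = i
        · subst hj; simp
        · rw [Function.update_of_ne hj,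
            Function.update_of_ne ((leftIdx_injective h).ne hj), join_leftIdx]
      · rw [Function.update_of_ne (leftIdx_ne_rightIdx h i j).symm, join_rightIdx]
    rw [key, key, key, ν.map_update_add]
  map_update_smul' := by
    intro inst u i c x
    have key : ∀ x, join h (Function.update u i x) v =
        Function.update (join h u v) (leftIdx h i) x := by
      intro x
      refine (eq_join h (fun j => ?_) (fun j => ?_)).symm
      · by_cases hj : j = i
        · subst hj; simp
        · rw [Function.update_of_ne hj,
            Function.update_of_ne ((leftIdx_injective h).ne hj), join_leftIdx]
      · rw [Function.update_of_ne (leftIdx_ne_rightIdx h i j).symm, join_rightIdx]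
    rw [key, key, ν.map_update_smul]

/-- Multilinear expansion in a basis. -/
theorem multilinear_expand {W A : Type*} [AddCommGroup W] [Module ℝ W] [AddCommGroup A] [Module ℝ A]
    (m : MultilinearMap ℝ (fun _ : Fin p => W) A) (b : Basis (Fin n) ℝ W) (u : Fin p → W) :
    m u = ∑ g : Fin p → Fin n, (∏ i, b.repr (u i) (g i)) • m (b ∘ g) := by
  have hu : u = fun i => ∑ j, b.repr (u i) j • b j := by
    funext i
    exact (b.sum_repr (u i)).symm
  conv_lhs => rw [hu, m.map_sum]
  refine Finset.sum_congr rfl fun g _ => ?_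
  exact m.map_smul_univ (fun i => b.repr (u i) (g i)) (fun i => b (g i))

theorem inv_gramMat_apply (b : Basis (Fin n) ℝ V) (i j : Fin n) :
    (gramMat b)⁻¹ i j = ∑ k, b.repr (onb V n k) i * b.repr (onb V n k) j := by
  have : (gramMat b)⁻¹ = b.toMatrix (onb V n) * (b.toMatrix (onb V n)).transpose := by
    refine Matrix.inv_eq_left_inv ?_
    rw [gramMat_eq_mul, ← Matrix.mul_assoc, Matrix.mul_assoc (b.toMatrix _), ← Matrix.transpose_mul]
    have h1 := (onb V n).toBasis.toMatrix_mul_toMatrix_flip b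
    have h2 := b.toMatrix_mul_toMatrix_flip (onb V n).toBasis
    rw [OrthonormalBasis.coe_toBasis] at h1 h2
    rw [h1, Matrix.transpose_one, Matrix.mul_one, h2]
  rw [this, Matrix.mul_apply]
  rfl

/-- The Hodge star in terms of an arbitrary basis and its inverse Gram matrix. -/
theorem hodgeStar_eq_sum_gram (h : p + q = n) (b : Basis (Fin n) ℝ V)
    (η : V [⋀^Fin p]→L[ℝ] 𝕜) (v : Fin q → V) :
    hodgeStar o h η v = ((p.factorial : ℕ) : 𝕜)⁻¹ * ∑ f : Fin p → Fin n, ∑ g : Fin p → Fin n,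
      ((∏ i, (gramMat b)⁻¹ (f i) (g i) : ℝ) : 𝕜) * (η (b ∘ f) *
        ((o.volumeForm (join h (b ∘ g) v) : ℝ) : 𝕜)) := by
  rw [hodgeStar_eq_sum_onb]
  congr 1
  have hη : ∀ f : Fin p → Fin n, η (onb V n ∘ f) =
      ∑ g : Fin p → Fin n, (((∏ i, b.repr (onb V n (f i)) (g i) : ℝ)) : 𝕜) * η (b ∘ g) := by
    intro f
    refine (multilinear_expand η.toMultilinearMap b (onb V n ∘ f)).trans ?_
    refine Finset.sum_congr rfl fun g _ => ?_
    rw [RCLike.real_smul_eq_coe_mul]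
    rfl
  have hν : ∀ f : Fin p → Fin n, ((o.volumeForm (join h (onb V n ∘ f) v) : ℝ) : 𝕜) =
      ∑ g : Fin p → Fin n, (((∏ i, b.repr (onb V n (f i)) (g i) : ℝ)) : 𝕜) *
        ((o.volumeForm (join h (b ∘ g) v) : ℝ) : 𝕜) := by
    intro f
    have := multilinear_expand (fixRight h o.volumeForm v) b (onb V n ∘ f)
    rw [show o.volumeForm (join h (onb V n ∘ f) v) = _ from this, RCLike.ofReal_sum]
    refine Finset.sum_congr rfl fun g _ => ?_
    rw [smul_eq_mul, RCLike.ofReal_mul]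
    rfl
  have hG : ∀ g g' : Fin p → Fin n, (∏ i, (gramMat b)⁻¹ (g i) (g' i)) =
      ∑ f : Fin p → Fin n, (∏ i, b.repr (onb V n (f i)) (g i)) *
        ∏ i, b.repr (onb V n (f i)) (g' i) := by
    intro g g'
    simp only [inv_gramMat_apply, ← Finset.prod_mul_distrib]
    rw [Finset.prod_univ_sum, Fintype.piFinset_univ]
  simp only [hη, hν, hG, RCLike.ofReal_sum, RCLike.ofReal_mul, Finset.sum_mul]
  rw [Finset.sum_comm]
  refine Finset.sum_congr rfl fun g _ => ?_
  rw [Finset.sum_comm]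
  refine Finset.sum_congr rfl fun f _ => ?_
  rw [Finset.mul_sum]
  refine Finset.sum_congr rfl fun g' _ => ?_
  ring

end Gram

/-! ### Coordinate frames -/

section Charts

variable {n : ℕ} {𝕜 : Type*} [RCLike 𝕜]
variable {M : Type*} [TopologicalSpace M] [ChartedSpace (EuclideanSpace ℝ (Fin n)) M]

variable (n) in
/-- The standard basis of `ℝⁿ`. -/
def stdB : Basis (Fin n) ℝ (EuclideanSpace ℝ (Fin n)) := (EuclideanSpace.basisFun (Fin n) ℝ).toBasis

theorem stdB_apply (i : Fin n) : stdB n i = EuclideanSpace.single i (1 : ℝ) := by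
  simp [stdB]

/-- The derivative of the inverse of the chart around `c`. -/
def paramDeriv (c : M) (y : EuclideanSpace ℝ (Fin n)) :
    EuclideanSpace ℝ (Fin n) →L[ℝ] TangentSpace (𝓡 n) ((extChartAt (𝓡 n) c).symm y) :=
  mfderiv 𝓘(ℝ, EuclideanSpace ℝ (Fin n)) (𝓡 n) (extChartAt (𝓡 n) c).symm y

theorem localRep_apply {p : ℕ} (θ : ∀ x : M, TangentSpace (𝓡 n) x [⋀^Fin p]→L[ℝ] 𝕜) (c : M)
    (y : EuclideanSpace ℝ (Fin n)) (u : Fin p → EuclideanSpace ℝ (Fin n)) :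
    localRep θ c y u = θ ((extChartAt (𝓡 n) c).symm y) (paramDeriv c y ∘ u) := rfl

variable [IsManifold (𝓡 n) ∞ M]

theorem contMDiffAt_symm (c : M) {y : EuclideanSpace ℝ (Fin n)}
    (hy : y ∈ (extChartAt (𝓡 n) c).target) :
    ContMDiffAt 𝓘(ℝ, EuclideanSpace ℝ (Fin n)) (𝓡 n) ∞ (extChartAt (𝓡 n) c).symm y :=
  (contMDiffOn_extChartAt_symm c).contMDiffAt ((isOpen_extChartAt_target c).mem_nhds hy)

theorem contMDiffAt_chart (c : M) {x : M} (hx : x ∈ (extChartAt (𝓡 n) c).source) :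
    ContMDiffAt (𝓡 n) 𝓘(ℝ, EuclideanSpace ℝ (Fin n)) ∞ (extChartAt (𝓡 n) c) x :=
  contMDiffAt_extChartAt' (by rwa [extChartAt_source] at hx)

theorem paramDeriv_comp_mfderiv (c : M) {y : EuclideanSpace ℝ (Fin n)}
    (hy : y ∈ (extChartAt (𝓡 n) c).target)
    (v : TangentSpace (𝓡 n) ((extChartAt (𝓡 n) c).symm y)) :
    paramDeriv c y (mfderiv (𝓡 n) 𝓘(ℝ, EuclideanSpace ℝ (Fin n)) (extChartAt (𝓡 n) c)
      ((extChartAt (𝓡 n) c).symm y) v) = v := by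
  have : IsManifold (𝓡 n) 1 M := IsManifold.of_le (n := ∞) (by simp)
  have h := mfderivWithin_extChartAt_symm_comp_mfderiv_extChartAt (I := 𝓡 n) hy
  simp only [ModelWithCorners.range_eq_univ, mfderivWithin_univ] at h
  exact congrArg (fun L => L v) h

theorem mfderiv_comp_paramDeriv (c : M) {y : EuclideanSpace ℝ (Fin n)}
    (hy : y ∈ (extChartAt (𝓡 n) c).target) (v : EuclideanSpace ℝ (Fin n)) :
    mfderiv (𝓡 n) 𝓘(ℝ, EuclideanSpace ℝ (Fin n)) (extChartAt (𝓡 n) c)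
      ((extChartAt (𝓡 n) c).symm y) (paramDeriv c y v) = v := by
  have : IsManifold (𝓡 n) 1 M := IsManifold.of_le (n := ∞) (by simp)
  have h := mfderiv_extChartAt_comp_mfderivWithin_extChartAt_symm (I := 𝓡 n) hy
  simp only [ModelWithCorners.range_eq_univ, mfderivWithin_univ] at h
  exact congrArg (fun L => L v) h

/-- The derivative of the inverse chart as an isomorphism. -/
def paramEquiv (c : M) {y : EuclideanSpace ℝ (Fin n)} (hy : y ∈ (extChartAt (𝓡 n) c).target) :
    EuclideanSpace ℝ (Fin n) ≃ₗ[ℝ] TangentSpace (𝓡 n) ((extChartAt (𝓡 n) c).symm y) where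
  toFun := paramDeriv c y
  map_add' := (paramDeriv c y).map_add
  map_smul' := (paramDeriv c y).map_smul
  invFun := mfderiv (𝓡 n) 𝓘(ℝ, EuclideanSpace ℝ (Fin n)) (extChartAt (𝓡 n) c)
      ((extChartAt (𝓡 n) c).symm y)
  left_inv := mfderiv_comp_paramDeriv c hy
  right_inv := paramDeriv_comp_mfderiv c hy

/-- The coordinate frame `∂₁, …, ∂ₙ` of a chart. -/
def frame (c : M) {y : EuclideanSpace ℝ (Fin n)} (hy : y ∈ (extChartAt (𝓡 n) c).target) :
    Basis (Fin n) ℝ (TangentSpace (𝓡 n) ((extChartAt (𝓡 n) c).symm y)) :=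
  (stdB n).map (paramEquiv c hy)

theorem coe_frame (c : M) {y : EuclideanSpace ℝ (Fin n)}
    (hy : y ∈ (extChartAt (𝓡 n) c).target) : ⇑(frame c hy) = paramDeriv c y ∘ stdB n := by
  funext i
  exact Basis.map_apply _ _ _

/-! ### Smoothness criteria for forms -/

/-- A map into alternating maps is smooth if its components are. -/
theorem contDiffAt_of_components {p : ℕ}
    {A : EuclideanSpace ℝ (Fin n) → EuclideanSpace ℝ (Fin n) [⋀^Fin p]→L[ℝ] 𝕜}
    {y : EuclideanSpace ℝ (Fin n)}
    (hA : ∀ g : Fin p → Fin n, ContDiffAt ℝ ∞ (fun z => A z (stdB n ∘ g)) y) :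
    ContDiffAt ℝ ∞ A y := by
  let ev : (EuclideanSpace ℝ (Fin n) [⋀^Fin p]→L[ℝ] 𝕜) →ₗ[ℝ] ((Fin p → Fin n) → 𝕜) :=
    { toFun := fun a g => a (stdB n ∘ g)
      map_add' := fun _ _ => rfl
      map_smul' := fun _ _ => rfl }
  have hev : LinearMap.ker ev = ⊥ := by
    rw [LinearMap.ker_eq_bot]
    intro a b hab
    refine ContinuousAlternatingMap.toAlternatingMap_injective ?_
    exact Basis.ext_alternating (stdB n) fun g _ => congrFun hab g
  obtain ⟨r, hr⟩ := LinearMap.exists_leftInverse_of_injective ev hev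
  have h1 : A = fun z => (LinearMap.toContinuousLinearMap r) (fun g => A z (stdB n ∘ g)) := by
    funext z
    exact (congrArg (fun L => L (A z)) hr).symm
  rw [h1]
  exact (LinearMap.toContinuousLinearMap r).contDiff.contDiffAt.comp y (contDiffAt_pi.2 hA)

theorem contDiffAt_apply_const {p : ℕ} {k : WithTop ℕ∞}
    {A : EuclideanSpace ℝ (Fin n) → EuclideanSpace ℝ (Fin n) [⋀^Fin p]→L[ℝ] 𝕜}
    {y : EuclideanSpace ℝ (Fin n)} (hA : ContDiffAt ℝ k A y)
    (u : Fin p → EuclideanSpace ℝ (Fin n)) : ContDiffAt ℝ k (fun z => A z u) y :=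
  (ContinuousAlternatingMap.apply ℝ (EuclideanSpace ℝ (Fin n)) 𝕜 u).contDiff.contDiffAt.comp y hA

/-- The transition map from the chart around `c` to the chart around `x`. -/
def transition (c x : M) (z : EuclideanSpace ℝ (Fin n)) : EuclideanSpace ℝ (Fin n) :=
  extChartAt (𝓡 n) x ((extChartAt (𝓡 n) c).symm z)

theorem contDiffAt_transition (c x : M) {y : EuclideanSpace ℝ (Fin n)}
    (hy : y ∈ (extChartAt (𝓡 n) c).target)
    (hyx : (extChartAt (𝓡 n) c).symm y ∈ (extChartAt (𝓡 n) x).source) :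
    ContDiffAt ℝ ∞ (transition c x) y :=
  ((contMDiffAt_chart x hyx).comp y (contMDiffAt_symm c hy)).contDiffAt

omit [IsManifold (𝓡 n) ∞ M] in
theorem symm_transition (c x : M) {y : EuclideanSpace ℝ (Fin n)}
    (hyx : (extChartAt (𝓡 n) c).symm y ∈ (extChartAt (𝓡 n) x).source) :
    (extChartAt (𝓡 n) x).symm (transition c x y) = (extChartAt (𝓡 n) c).symm y :=
  (extChartAt (𝓡 n) x).left_inv hyx

theorem eventually_overlap (c x : M) {y : EuclideanSpace ℝ (Fin n)}
    (hy : y ∈ (extChartAt (𝓡 n) c).target)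
    (hyx : (extChartAt (𝓡 n) c).symm y ∈ (extChartAt (𝓡 n) x).source) :
    ∀ᶠ z in 𝓝 y, z ∈ (extChartAt (𝓡 n) c).target ∧
      (extChartAt (𝓡 n) c).symm z ∈ (extChartAt (𝓡 n) x).source :=
  ((isOpen_extChartAt_target c).eventually_mem hy).and
    ((contMDiffAt_symm c hy).continuousAt.eventually_mem ((isOpen_extChartAt_source x).mem_nhds hyx))

/-- The chain rule for the two parametrisations of an overlap. Tangent spaces at equal points are
compared in the model space. -/
theorem paramDeriv_transition (c x : M) {y : EuclideanSpace ℝ (Fin n)}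
    (hy : y ∈ (extChartAt (𝓡 n) c).target)
    (hyx : (extChartAt (𝓡 n) c).symm y ∈ (extChartAt (𝓡 n) x).source) :
    (paramDeriv c y : EuclideanSpace ℝ (Fin n) →L[ℝ] EuclideanSpace ℝ (Fin n)) =
      (paramDeriv x (transition c x y) :
        EuclideanSpace ℝ (Fin n) →L[ℝ] EuclideanSpace ℝ (Fin n)).comp
          (fderiv ℝ (transition c x) y) := by
  have hfz : transition c x y ∈ (extChartAt (𝓡 n) x).target :=
    (extChartAt (𝓡 n) x).map_source hyx
  have hev : (extChartAt (𝓡 n) c).symm =ᶠ[𝓝 y] (extChartAt (𝓡 n) x).symm ∘ transition c x := by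
    filter_upwards [eventually_overlap c x hy hyx] with w hw using (symm_transition c x hw.2).symm
  have h1 := hev.mfderiv_eq (I := 𝓘(ℝ, EuclideanSpace ℝ (Fin n))) (I' := 𝓡 n)
  have h2 := mfderiv_comp y ((contMDiffAt_symm x hfz).mdifferentiableAt (by simp))
    ((contDiffAt_transition c x hy hyx).contMDiffAt.mdifferentiableAt (by simp))
  rw [mfderiv_eq_fderiv] at h2
  exact h1.trans h2

theorem localRep_eq_pullback {p : ℕ} (θ : ∀ x : M, TangentSpace (𝓡 n) x [⋀^Fin p]→L[ℝ] 𝕜)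
    (c x : M) {y : EuclideanSpace ℝ (Fin n)}
    (hy : y ∈ (extChartAt (𝓡 n) c).target)
    (hyx : (extChartAt (𝓡 n) c).symm y ∈ (extChartAt (𝓡 n) x).source) :
    localRep θ c y = (localRep θ x (transition c x y)).compContinuousLinearMap
      (fderiv ℝ (transition c x) y) := by
  -- the two base points are equal only propositionally
  have aux : ∀ (b : M) (_ : b = (extChartAt (𝓡 n) c).symm y)
      (L : EuclideanSpace ℝ (Fin n) →L[ℝ] TangentSpace (𝓡 n) b)
      (L' : EuclideanSpace ℝ (Fin n) →L[ℝ] TangentSpace (𝓡 n) ((extChartAt (𝓡 n) c).symm y))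
      (_ : (L : EuclideanSpace ℝ (Fin n) →L[ℝ] EuclideanSpace ℝ (Fin n)) = L'),
      (θ b).compContinuousLinearMap L =
        (θ ((extChartAt (𝓡 n) c).symm y)).compContinuousLinearMap L' := by
    rintro b rfl L L' h
    exact congrArg (fun L => (θ ((extChartAt (𝓡 n) c).symm y)).compContinuousLinearMap L) h
  exact (aux _ (symm_transition c x hyx) _ _ (paramDeriv_transition c x hy hyx).symm).symm

/-- A form is smooth if around every point it is smooth in the chart centred there. -/
theorem mem_smoothForm_of_contDiffAt {p : ℕ}
    {θ : ∀ x : M, TangentSpace (𝓡 n) x [⋀^Fin p]→L[ℝ] 𝕜}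
    (hθ : ∀ c : M, ContDiffAt ℝ ∞ (localRep θ c) (extChartAt (𝓡 n) c c)) :
    θ ∈ SmoothForm n 𝕜 M p := by
  intro c y hy
  refine ContDiffAt.contDiffWithinAt ?_
  set x := (extChartAt (𝓡 n) c).symm y with hx
  have hyx : (extChartAt (𝓡 n) c).symm y ∈ (extChartAt (𝓡 n) x).source :=
    mem_extChartAt_source x
  have hev : localRep θ c =ᶠ[𝓝 y] fun z => (localRep θ x (transition c x z)).compContinuousLinearMap
      (fderiv ℝ (transition c x) z) := by
    filter_upwards [eventually_overlap c x hy hyx] with z hz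
    exact localRep_eq_pullback θ c x hz.1 hz.2
  refine ContDiffAt.congr_of_eventuallyEq (contDiffAt_of_components fun g => ?_) hev
  have hexp : ∀ z, (localRep θ x (transition c x z)).compContinuousLinearMap
      (fderiv ℝ (transition c x) z) (stdB n ∘ g) = ∑ k : Fin p → Fin n,
        (∏ i, (fderiv ℝ (transition c x) z (stdB n (g i))) (k i)) •
          localRep θ x (transition c x z) (stdB n ∘ k) := by
    intro z
    exact multilinear_expand (localRep θ x (transition c x z)).toMultilinearMap (stdB n)
      (fun i => fderiv ℝ (transition c x) z (stdB n (g i)))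
  simp only [hexp]
  have ht := contDiffAt_transition c x hy hyx
  have ht' : ContDiffAt ℝ ∞ (fderiv ℝ (transition c x)) y := ht.fderiv_right (by simp)
  refine ContDiffAt.sum fun k _ => ContDiffAt.fun_smul (contDiffAt_prod fun i _ => ?_) ?_
  · exact (EuclideanSpace.proj (𝕜 := ℝ) (k i)).contDiff.contDiffAt.comp y
      (ht'.clm_apply contDiffAt_const)
  · exact contDiffAt_apply_const ((hθ x).comp y ht) _

omit [IsManifold (𝓡 n) ∞ M] in
theorem contDiffAt_localRep {p : ℕ} (θ : SmoothForm n 𝕜 M p) (c : M)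
    {y : EuclideanSpace ℝ (Fin n)} (hy : y ∈ (extChartAt (𝓡 n) c).target) :
    ContDiffAt ℝ ∞ (localRep θ.1 c) y :=
  (θ.2 c).contDiffAt ((isOpen_extChartAt_target c).mem_nhds hy)

end Charts

/-! ### The metric in coordinates and smoothness of the Hodge star -/

section Metric

variable {n : ℕ} {𝕜 : Type*} [RCLike 𝕜]
variable {M : Type*} [TopologicalSpace M] [ChartedSpace (EuclideanSpace ℝ (Fin n)) M]
variable [IsManifold (𝓡 n) ∞ M]
variable [RiemannianBundle (fun x : M => TangentSpace (𝓡 n) x)]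

theorem gram_eq_gramMat (c : M) {y : EuclideanSpace ℝ (Fin n)}
    (hy : y ∈ (extChartAt (𝓡 n) c).target) : gram c y = gramMat (frame c hy) := by
  ext i j
  rw [gramMat, coe_frame]
  simp only [Function.comp_apply, stdB_apply]
  rfl

theorem det_gram_pos (c : M) {y : EuclideanSpace ℝ (Fin n)}
    (hy : y ∈ (extChartAt (𝓡 n) c).target) : 0 < (gram c y).det := by
  rw [gram_eq_gramMat c hy]
  exact det_gramMat_pos _

theorem sqrt_det_gram_pos (c : M) {y : EuclideanSpace ℝ (Fin n)}
    (hy : y ∈ (extChartAt (𝓡 n) c).target) : 0 < Real.sqrt (gram c y).det :=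
  Real.sqrt_pos.2 (det_gram_pos c hy)

omit [RiemannianBundle (fun x : M => TangentSpace (𝓡 n) x)] in
theorem contMDiffAt_paramDeriv_section (c : M) (v : EuclideanSpace ℝ (Fin n))
    {y : EuclideanSpace ℝ (Fin n)} (hy : y ∈ (extChartAt (𝓡 n) c).target) :
    ContMDiffAt 𝓘(ℝ, EuclideanSpace ℝ (Fin n)) (𝓡 n).tangent ∞
      (fun z => (⟨(extChartAt (𝓡 n) c).symm z, paramDeriv c z v⟩ : TangentBundle (𝓡 n) M)) y := by
  have : IsManifold (𝓡 n) 1 M := IsManifold.of_le (n := ∞) (by simp)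
  have hT := isOpen_extChartAt_target (I := 𝓡 n) c
  have h1 := (contMDiffOn_extChartAt_symm (I := 𝓡 n) (n := ∞) c).contMDiffOn_tangentMapWithin
    (m := ∞) (by simp) hT.uniqueMDiffOn
  have h2 : ContMDiffOn 𝓘(ℝ, EuclideanSpace ℝ (Fin n))
      (𝓘(ℝ, EuclideanSpace ℝ (Fin n))).tangent ∞
      (fun z => (⟨z, v⟩ : TangentBundle 𝓘(ℝ, EuclideanSpace ℝ (Fin n)) (EuclideanSpace ℝ (Fin n))))
      (extChartAt (𝓡 n) c).target :=
    contMDiffOn_vectorSpace_iff_contDiffOn.2 contDiffOn_const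
  have h3 := (h1.comp h2 fun z hz => hz).contMDiffAt (hT.mem_nhds hy)
  refine h3.congr_of_eventuallyEq ?_
  filter_upwards [hT.mem_nhds hy] with z hz
  simp only [Function.comp_apply, tangentMapWithin, mfderivWithin_of_isOpen hT hz]
  rfl

variable [IsContMDiffRiemannianBundle (𝓡 n) ∞ (EuclideanSpace ℝ (Fin n))
      (fun x : M => TangentSpace (𝓡 n) x)]

theorem contDiffAt_gram (c : M) {y : EuclideanSpace ℝ (Fin n)}
    (hy : y ∈ (extChartAt (𝓡 n) c).target) (i j : Fin n) :
    ContDiffAt ℝ ∞ (fun z => gram c z i j) y :=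
  (ContMDiffAt.inner_bundle (contMDiffAt_paramDeriv_section c (EuclideanSpace.single i (1 : ℝ)) hy)
    (contMDiffAt_paramDeriv_section c (EuclideanSpace.single j (1 : ℝ)) hy)).contDiffAt

theorem contDiffAt_det {m : ℕ} {A : EuclideanSpace ℝ (Fin n) → Matrix (Fin m) (Fin m) ℝ}
    {y : EuclideanSpace ℝ (Fin n)} (hA : ∀ i j, ContDiffAt ℝ ∞ (fun z => A z i j) y) :
    ContDiffAt ℝ ∞ (fun z => (A z).det) y := by
  simp only [Matrix.det_apply, Units.smul_def]
  exact ContDiffAt.sum fun σ _ => ContDiffAt.const_smul _ (contDiffAt_prod fun i _ => hA _ _)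

theorem contDiffAt_inv_gram (c : M) {y : EuclideanSpace ℝ (Fin n)}
    (hy : y ∈ (extChartAt (𝓡 n) c).target) (i j : Fin n) :
    ContDiffAt ℝ ∞ (fun z => (gram c z)⁻¹ i j) y := by
  simp only [Matrix.inv_def, Matrix.smul_apply, Matrix.adjugate_apply, smul_eq_mul,
    Ring.inverse_eq_inv']
  refine ContDiffAt.mul ((contDiffAt_det (contDiffAt_gram c hy)).inv (det_gram_pos c hy).ne')
    (contDiffAt_det fun k l => ?_)
  simp only [Matrix.updateRow_apply]
  split_ifs
  · exact contDiffAt_const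
  · exact contDiffAt_gram c hy k l

theorem contDiffAt_sqrt_det_gram (c : M) {y : EuclideanSpace ℝ (Fin n)}
    (hy : y ∈ (extChartAt (𝓡 n) c).target) :
    ContDiffAt ℝ ∞ (fun z => Real.sqrt (gram c z).det) y :=
  (contDiffAt_det (contDiffAt_gram c hy)).sqrt (det_gram_pos c hy).ne'

omit [IsContMDiffRiemannianBundle (𝓡 n) ∞ (EuclideanSpace ℝ (Fin n))
      (fun x : M => TangentSpace (𝓡 n) x)] in
/-- Around the centre of a chart, the volume form of an oriented manifold is `± √(det g)` in the
coordinate frame, with a constant sign. -/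
theorem exists_sign_volumeForm (o : ManifoldOrientation n M) (c : M) :
    ∃ s : ℝ, (s = 1 ∨ s = -1) ∧ ∃ U : Set M, IsOpen U ∧ c ∈ U ∧
      U ⊆ (extChartAt (𝓡 n) c).source ∧ ∀ y ∈ (extChartAt (𝓡 n) c).target,
        (extChartAt (𝓡 n) c).symm y ∈ U →
        (o.at_ ((extChartAt (𝓡 n) c).symm y)).volumeForm (paramDeriv c y ∘ stdB n) =
          s * Real.sqrt (gram c y).det := by
  obtain ⟨o', ho'⟩ := o.locally_constant c
  obtain ⟨U, hU, hUo, hcU⟩ := mem_nhds_iff.1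
    (ho'.and ((isOpen_extChartAt_source (I := 𝓡 n) c).mem_nhds (mem_extChartAt_source c)))
  classical
  refine ⟨if (stdB n).orientation = o' then 1 else -1, by split_ifs <;> simp, U, hUo, hcU,
    fun x hx => (hU hx).2, fun y hy hyU => ?_⟩
  obtain ⟨⟨L, hL, hLo⟩, -⟩ := hU hyU
  have hLe : L = (paramEquiv c hy).symm := LinearEquiv.ext hL
  have hor : (frame c hy).orientation = o.at_ ((extChartAt (𝓡 n) c).symm y) ↔
      (stdB n).orientation = o' := by
    rw [frame, Basis.orientation_map, ← hLo, hLe]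
    constructor
    · intro h
      rw [← h]
      exact ((Orientation.map (Fin n) (paramEquiv c hy)).symm_apply_apply _).symm
    · intro h
      rw [h]
      exact (Orientation.map (Fin n) (paramEquiv c hy)).apply_symm_apply _
  rw [← coe_frame c hy, gram_eq_gramMat c hy]
  split_ifs with h
  · rw [one_mul]
    exact volumeForm_of_orientation_eq _ _ (hor.2 h)
  · rw [neg_one_mul]
    exact volumeForm_of_orientation_ne _ _ fun h' => h (hor.1 h')

/-- The Hodge star of a form, pointwise. -/
def starFun {p q : ℕ} (o : ManifoldOrientation n M) (h : p + q = n)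
    (θ : ∀ x : M, TangentSpace (𝓡 n) x [⋀^Fin p]→L[ℝ] 𝕜) (x : M) :
    TangentSpace (𝓡 n) x [⋀^Fin q]→L[ℝ] 𝕜 := hodgeStar (o.at_ x) h (θ x)

/-- The Hodge star of a smooth form is smooth. -/
theorem starFun_mem {p q : ℕ} (o : ManifoldOrientation n M) (h : p + q = n)
    (θ : SmoothForm n 𝕜 M p) : starFun o h θ.1 ∈ SmoothForm n 𝕜 M q := by
  refine mem_smoothForm_of_contDiffAt fun c => ?_
  -- near `c`, the components of `⋆θ` are given by the inverse Gram matrix, with a constant sign `s`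
  obtain ⟨s, -, U, hUo, hcU, hUs, hU⟩ := exists_sign_volumeForm o c
  have hy := mem_extChartAt_target (I := 𝓡 n) c
  refine contDiffAt_of_components fun g => ?_
  have hev : (fun z => localRep (starFun o h θ.1) c z (stdB n ∘ g)) =ᶠ[𝓝 (extChartAt (𝓡 n) c c)]
      fun z => ((p.factorial : ℕ) : 𝕜)⁻¹ * ∑ f : Fin p → Fin n, ∑ k : Fin p → Fin n,
        ((∏ i, (gram c z)⁻¹ (f i) (k i) : ℝ) : 𝕜) * (localRep θ.1 c z (stdB n ∘ f) *
          ((s * Real.sqrt (gram c z).det * (stdB n).det (stdB n ∘ join h k g) : ℝ) : 𝕜)) := by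
    have hnear : ∀ᶠ z in 𝓝 (extChartAt (𝓡 n) c c), (extChartAt (𝓡 n) c).symm z ∈ U :=
      (contMDiffAt_symm c hy).continuousAt.eventually_mem (by
        rw [extChartAt_to_inv]; exact hUo.mem_nhds hcU)
    filter_upwards [hnear, (isOpen_extChartAt_target (I := 𝓡 n) c).mem_nhds hy] with z hzU hz
    rw [localRep_apply]
    refine (hodgeStar_eq_sum_gram (o.at_ _) h (frame c hz) _ _).trans ?_
    congr 1
    refine Finset.sum_congr rfl fun f _ => Finset.sum_congr rfl fun k _ => ?_
    rw [← gram_eq_gramMat c hz, coe_frame, localRep_apply]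
    congr 2
    have hν : ∀ w : Fin n → EuclideanSpace ℝ (Fin n),
        (o.at_ ((extChartAt (𝓡 n) c).symm z)).volumeForm (paramDeriv c z ∘ w) =
        (o.at_ ((extChartAt (𝓡 n) c).symm z)).volumeForm (paramDeriv c z ∘ stdB n) *
          (stdB n).det w := by
      intro w
      have := AlternatingMap.eq_smul_basis_det (stdB n)
        ((o.at_ ((extChartAt (𝓡 n) c).symm z)).volumeForm.compLinearMap (paramDeriv c z).toLinearMap)
      exact congrArg (fun ν => ν w) this
    rw [← hU z hz hzU, ← hν]
    congr 2
    rw [comp_join, comp_join]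
    rfl
  refine ContDiffAt.congr_of_eventuallyEq ?_ hev
  have hre : ∀ {F : EuclideanSpace ℝ (Fin n) → ℝ}, ContDiffAt ℝ ∞ F (extChartAt (𝓡 n) c c) →
      ContDiffAt ℝ ∞ (fun z => ((F z : ℝ) : 𝕜)) (extChartAt (𝓡 n) c c) := fun hF =>
    (RCLike.ofRealCLM (K := 𝕜)).contDiff.contDiffAt.comp _ hF
  refine contDiffAt_const.mul (ContDiffAt.sum fun f _ => ContDiffAt.sum fun k _ =>
    ContDiffAt.mul (hre ?_) (ContDiffAt.mul ?_ (hre ?_)))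
  · exact contDiffAt_prod fun i _ => contDiffAt_inv_gram c hy _ _
  · exact contDiffAt_apply_const (contDiffAt_localRep θ c hy) _
  · exact (contDiffAt_const.mul (contDiffAt_sqrt_det_gram c hy)).mul contDiffAt_const

end Metric

/-! ### The Riemannian volume measure in a chart -/

section Volume

variable {n : ℕ} {𝕜 : Type*} [RCLike 𝕜]
variable {M : Type*} [TopologicalSpace M] [ChartedSpace (EuclideanSpace ℝ (Fin n)) M]

section Pointwise

variable {V : Type*} [NormedAddCommGroup V] [InnerProductSpace ℝ V] [FiniteDimensional ℝ V]

/-- The transformation rule of `√(det g)` under a change of coordinates with derivative `D`. -/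
theorem sqrt_det_gramMat_comp [Fact (finrank ℝ V = n)]
    (L : EuclideanSpace ℝ (Fin n) →L[ℝ] V)
    (D : EuclideanSpace ℝ (Fin n) →L[ℝ] EuclideanSpace ℝ (Fin n)) :
    Real.sqrt (gramMat (L.comp D ∘ stdB n)).det =
      |D.det| * Real.sqrt (gramMat (L ∘ stdB n)).det := by
  have o : Orientation ℝ V (Fin n) := (onb V n).toBasis.orientation
  rw [det_gramMat o, det_gramMat o, Real.sqrt_sq_eq_abs, Real.sqrt_sq_eq_abs, ← abs_mul]
  congr 1
  have hν : ∀ w : Fin n → EuclideanSpace ℝ (Fin n),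
      o.volumeForm (L ∘ w) = o.volumeForm (L ∘ stdB n) * (stdB n).det w := fun w =>
    congrArg (fun ν => ν w) (AlternatingMap.eq_smul_basis_det (stdB n)
      (o.volumeForm.compLinearMap L.toLinearMap))
  have h2 := hν (D ∘ stdB n)
  have h3 := (stdB n).det_comp D.toLinearMap (stdB n)
  rw [Basis.det_self, mul_one] at h3
  rw [mul_comm]
  refine h2.trans ?_
  congr 1

end Pointwise

theorem measurableSet_preimage_symm [MeasurableSpace M] [BorelSpace M] (c : M) {s : Set M}
    (hs : MeasurableSet s) :
    MeasurableSet ((extChartAt (𝓡 n) c).target ∩ (extChartAt (𝓡 n) c).symm ⁻¹' s) := by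
  have hT := (isOpen_extChartAt_target (I := 𝓡 n) c).measurableSet
  have h1 : Measurable ((extChartAt (𝓡 n) c).target.domRestrict (extChartAt (𝓡 n) c).symm) :=
    (continuousOn_iff_continuous_domRestrict.1 (continuousOn_extChartAt_symm c)).measurable
  convert! hT.subtype_image (h1 hs) using 1
  ext y
  constructor
  · rintro ⟨hy, hys⟩
    exact ⟨⟨y, hy⟩, hys, rfl⟩
  · rintro ⟨⟨z, hz⟩, hzs, rfl⟩
    exact ⟨hz, hzs⟩

theorem aemeasurable_symm [MeasurableSpace M] [BorelSpace M] (c : M) :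
    AEMeasurable (extChartAt (𝓡 n) c).symm
      ((volume : Measure (EuclideanSpace ℝ (Fin n))).restrict (extChartAt (𝓡 n) c).target) :=
  (continuousOn_extChartAt_symm c).aemeasurable (isOpen_extChartAt_target c).measurableSet

variable [RiemannianBundle (fun x : M => TangentSpace (𝓡 n) x)]

/-- The density `√(det g)` of the Riemannian volume in a chart. -/
def chartDensity (c : M) (y : EuclideanSpace ℝ (Fin n)) : ℝ := Real.sqrt (gram c y).det

variable [MeasurableSpace M] [BorelSpace M]

theorem chartVolume_apply (c : M) {s : Set M} (hs : MeasurableSet s) :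
    chartVolume (n := n) c s =
      ∫⁻ y in (extChartAt (𝓡 n) c).target ∩ (extChartAt (𝓡 n) c).symm ⁻¹' s,
        ENNReal.ofReal (chartDensity c y) := by
  rw [chartVolume, Measure.map_apply_of_aemeasurable
    ((aemeasurable_symm c).mono_ac (withDensity_absolutelyContinuous _ _)) hs,
    withDensity_apply', Measure.restrict_restrict₀, inter_comm]
  · rfl
  · exact (aemeasurable_symm c).nullMeasurable hs

theorem chartVolume_compl_source (c : M) :
    chartVolume (n := n) c (extChartAt (𝓡 n) c).sourceᶜ = 0 := by
  rw [chartVolume_apply c (isOpen_extChartAt_source c).measurableSet.compl]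
  have : (extChartAt (𝓡 n) c).target ∩
      (extChartAt (𝓡 n) c).symm ⁻¹' (extChartAt (𝓡 n) c).sourceᶜ = ∅ := by
    ext y
    simp only [mem_inter_iff, mem_preimage, mem_compl_iff, mem_empty_iff_false, iff_false, not_and,
      not_not]
    exact fun hy => (extChartAt (𝓡 n) c).map_target hy
  rw [this, Measure.restrict_empty, lintegral_zero_measure]

theorem chartVolume_inter_source (c : M) (s : Set M) :
    chartVolume (n := n) c (s ∩ (extChartAt (𝓡 n) c).source) = chartVolume (n := n) c s :=
  measure_inter_conull (chartVolume_compl_source c)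

variable [IsManifold (𝓡 n) ∞ M]

omit [MeasurableSpace M] [BorelSpace M] in
theorem chartDensity_transition (c x : M) {y : EuclideanSpace ℝ (Fin n)}
    (hy : y ∈ (extChartAt (𝓡 n) c).target)
    (hyx : (extChartAt (𝓡 n) c).symm y ∈ (extChartAt (𝓡 n) x).source) :
    chartDensity c y = |(fderiv ℝ (transition c x) y).det| * chartDensity x (transition c x y) := by
  have hfz : transition c x y ∈ (extChartAt (𝓡 n) x).target :=
    (extChartAt (𝓡 n) x).map_source hyx
  rw [chartDensity, chartDensity, gram_eq_gramMat c hy, gram_eq_gramMat x hfz, coe_frame, coe_frame,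
    ← sqrt_det_gramMat_comp]
  -- the two base points are equal only propositionally
  have aux : ∀ (b : M) (_ : b = (extChartAt (𝓡 n) c).symm y)
      (L : EuclideanSpace ℝ (Fin n) →L[ℝ] TangentSpace (𝓡 n) b)
      (L' : EuclideanSpace ℝ (Fin n) →L[ℝ] TangentSpace (𝓡 n) ((extChartAt (𝓡 n) c).symm y))
      (_ : (L : EuclideanSpace ℝ (Fin n) →L[ℝ] EuclideanSpace ℝ (Fin n)) = L'),
      gramMat (L ∘ stdB n) = gramMat (L' ∘ stdB n) := by
    rintro b rfl L L' h
    exact congrArg (fun L : EuclideanSpace ℝ (Fin n) →L[ℝ]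
      TangentSpace (𝓡 n) ((extChartAt (𝓡 n) c).symm y) => gramMat (L ∘ stdB n)) h
  exact congrArg (fun G => Real.sqrt (Matrix.det G)) (aux _ (symm_transition c x hyx) _ _
    (paramDeriv_transition c x hy hyx).symm).symm

/-- The chart measures agree on overlaps. -/
theorem chartVolume_eq_of_subset (c x : M) {s : Set M} (hs : MeasurableSet s)
    (hc : s ⊆ (extChartAt (𝓡 n) c).source) (hx : s ⊆ (extChartAt (𝓡 n) x).source) :
    chartVolume (n := n) c s = chartVolume (n := n) x s := by
  rw [chartVolume_apply c hs, chartVolume_apply x hs]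
  set A := (extChartAt (𝓡 n) c).target ∩ (extChartAt (𝓡 n) c).symm ⁻¹' s with hA
  have himg : (extChartAt (𝓡 n) x).target ∩ (extChartAt (𝓡 n) x).symm ⁻¹' s =
      transition c x '' A := by
    ext z
    constructor
    · rintro ⟨hz, hzs⟩
      refine ⟨transition x c z, ⟨(extChartAt (𝓡 n) c).map_source (hc hzs), ?_⟩, ?_⟩
      · rw [mem_preimage, symm_transition x c (hc hzs)]
        exact hzs
      · rw [transition, symm_transition x c (hc hzs)]
        exact (extChartAt (𝓡 n) x).right_inv hz
    · rintro ⟨y, ⟨hy, hys⟩, rfl⟩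
      refine ⟨(extChartAt (𝓡 n) x).map_source (hx hys), ?_⟩
      rw [mem_preimage, symm_transition c x (hx hys)]
      exact hys
  have hinj : InjOn (transition c x) A := by
    intro y hy z hz hyz
    have h1 := congrArg (extChartAt (𝓡 n) x).symm hyz
    rw [symm_transition c x (hx hy.2), symm_transition c x (hx hz.2)] at h1
    rw [← (extChartAt (𝓡 n) c).right_inv hy.1, ← (extChartAt (𝓡 n) c).right_inv hz.1, h1]
  have hAm : MeasurableSet A := measurableSet_preimage_symm c hs
  rw [himg, lintegral_image_eq_lintegral_abs_det_fderiv_mul volume hAm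
    (fun y hy => ((contDiffAt_transition c x hy.1 (hx hy.2)).differentiableAt
      (by simp)).hasFDerivAt.hasFDerivWithinAt) hinj]
  refine setLIntegral_congr_fun hAm fun y hy => ?_
  rw [chartDensity_transition c x hy.1 (hx hy.2), ENNReal.ofReal_mul (abs_nonneg _)]

/-- The glued measure restricts to the chart measure on every chart domain. -/
theorem riemannianVolume_restrict_source (c : M) :
    (riemannianVolume n M).restrict (extChartAt (𝓡 n) c).source = chartVolume (n := n) c := by
  set U := (extChartAt (𝓡 n) c).source with hU
  have hUm : MeasurableSet U := (isOpen_extChartAt_source c).measurableSet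
  have hself : (chartVolume (n := n) c).restrict U = chartVolume (n := n) c := by
    refine Measure.ext fun s hs => ?_
    rw [Measure.restrict_apply hs, chartVolume_inter_source]
  refine le_antisymm ?_ ?_
  · -- the measure on the right dominates every chart measure: on `U` by agreement on overlaps, off
    -- `U` trivially
    have hle : riemannianVolume n M ≤
        chartVolume (n := n) c + (riemannianVolume n M).restrict Uᶜ := by
      conv_lhs => rw [riemannianVolume]
      refine iSup_le fun x => ?_
      rw [← Measure.restrict_add_restrict_compl (μ := chartVolume (n := n) x) hUm]
      refine add_le_add ?_ (Measure.restrict_mono le_rfl (le_iSup (chartVolume (n := n)) x))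
      refine Measure.le_iff.2 fun s hs => ?_
      have hm : MeasurableSet (s ∩ U ∩ (extChartAt (𝓡 n) x).source) :=
        (hs.inter hUm).inter (isOpen_extChartAt_source x).measurableSet
      rw [Measure.restrict_apply hs, ← chartVolume_inter_source x,
        chartVolume_eq_of_subset x c hm (fun _ h => h.2) (fun _ h => h.1.2)]
      exact measure_mono fun _ h => h.1.1
    refine (Measure.restrict_mono le_rfl hle).trans ?_
    rw [Measure.restrict_add, Measure.restrict_restrict hUm, inter_compl_self,
      Measure.restrict_empty, add_zero, hself]
  · rw [← hself]
    exact Measure.restrict_mono le_rfl (le_iSup (chartVolume (n := n)) c)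

variable [IsContMDiffRiemannianBundle (𝓡 n) ∞ (EuclideanSpace ℝ (Fin n))
      (fun x : M => TangentSpace (𝓡 n) x)]

omit [MeasurableSpace M] [BorelSpace M] in
theorem contDiffOn_chartDensity (c : M) :
    ContDiffOn ℝ ∞ (chartDensity c) (extChartAt (𝓡 n) c).target :=
  fun _ hy => (contDiffAt_sqrt_det_gram c hy).contDiffWithinAt

omit [MeasurableSpace M] [BorelSpace M] in
theorem aemeasurable_chartDensity (c : M) :
    AEMeasurable (fun y => ENNReal.ofReal (chartDensity c y))
      ((volume : Measure (EuclideanSpace ℝ (Fin n))).restrict (extChartAt (𝓡 n) c).target) :=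
  ((contDiffOn_chartDensity c).continuousOn.aemeasurable
    (isOpen_extChartAt_target c).measurableSet).ennreal_ofReal

/-- The integral of a function that vanishes off a chart domain, in coordinates. -/
theorem integral_riemannianVolume (c : M) {F : M → 𝕜} (hF : Continuous F)
    (hc : ∀ x, x ∉ (extChartAt (𝓡 n) c).source → F x = 0) :
    ∫ x, F x ∂(riemannianVolume n M) = ∫ y in (extChartAt (𝓡 n) c).target,
      chartDensity c y • F ((extChartAt (𝓡 n) c).symm y) := by
  rw [← setIntegral_eq_integral_of_forall_compl_eq_zero hc, riemannianVolume_restrict_source,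
    chartVolume, integral_map ((aemeasurable_symm c).mono_ac (withDensity_absolutelyContinuous _ _))
      hF.aestronglyMeasurable]
  refine (integral_withDensity_eq_integral_toReal_smul₀ (aemeasurable_chartDensity c)
    (Filter.Eventually.of_forall fun _ => ENNReal.ofReal_lt_top) _).trans ?_
  refine integral_congr_ae (Filter.Eventually.of_forall fun y => ?_)
  change (ENNReal.ofReal (chartDensity c y)).toReal • _ = _
  rw [ENNReal.toReal_ofReal (show 0 ≤ chartDensity c y from Real.sqrt_nonneg _)]

omit [IsContMDiffRiemannianBundle (𝓡 n) ∞ (EuclideanSpace ℝ (Fin n))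
      (fun x : M => TangentSpace (𝓡 n) x)] in
theorem riemannianVolume_apply_of_subset (c : M) {s : Set M} (hs : MeasurableSet s)
    (hc : s ⊆ (extChartAt (𝓡 n) c).source) :
    riemannianVolume n M s =
      ∫⁻ y in (extChartAt (𝓡 n) c).target ∩ (extChartAt (𝓡 n) c).symm ⁻¹' s,
        ENNReal.ofReal (chartDensity c y) := by
  rw [← chartVolume_apply c hs, ← riemannianVolume_restrict_source, Measure.restrict_apply hs,
    inter_eq_left.2 hc]

theorem isLocallyFiniteMeasure_riemannianVolume :
    IsLocallyFiniteMeasure (riemannianVolume n M) := by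
  refine ⟨fun x => ?_⟩
  have hx := mem_extChartAt_target (I := 𝓡 n) x
  have hw : ContinuousAt (chartDensity x) (extChartAt (𝓡 n) x x) :=
    (contDiffAt_sqrt_det_gram x hx).continuousAt
  have hnhds : {z | chartDensity x z < chartDensity x (extChartAt (𝓡 n) x x) + 1} ∩
      Metric.ball (extChartAt (𝓡 n) x x) 1 ∈ 𝓝 (extChartAt (𝓡 n) x x) :=
    Filter.inter_mem (hw.eventually_lt_const (by linarith)) (Metric.ball_mem_nhds _ one_pos)
  obtain ⟨B, hBs, hBo, hxB⟩ := mem_nhds_iff.1 hnhds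
  have hso : IsOpen ((extChartAt (𝓡 n) x).source ∩ extChartAt (𝓡 n) x ⁻¹' B) :=
    (continuousOn_extChartAt x).isOpen_inter_preimage (isOpen_extChartAt_source x) hBo
  refine ⟨_, hso.mem_nhds ⟨mem_extChartAt_source x, hxB⟩, ?_⟩
  rw [riemannianVolume_apply_of_subset x hso.measurableSet inter_subset_left]
  have hsub : (extChartAt (𝓡 n) x).target ∩ (extChartAt (𝓡 n) x).symm ⁻¹'
      ((extChartAt (𝓡 n) x).source ∩ extChartAt (𝓡 n) x ⁻¹' B) ⊆ B := by
    rintro y ⟨hy, -, hyB⟩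
    rwa [mem_preimage, (extChartAt (𝓡 n) x).right_inv hy] at hyB
  calc _ ≤ ∫⁻ y in B, ENNReal.ofReal (chartDensity x y) := lintegral_mono_set hsub
    _ ≤ ∫⁻ _ in B, ENNReal.ofReal (chartDensity x (extChartAt (𝓡 n) x x) + 1) :=
        setLIntegral_mono' hBo.measurableSet fun y hy => ENNReal.ofReal_le_ofReal (hBs hy).1.le
    _ = ENNReal.ofReal (chartDensity x (extChartAt (𝓡 n) x x) + 1) * volume B :=
        setLIntegral_const _ _
    _ < ⊤ := ENNReal.mul_lt_top ENNReal.ofReal_lt_top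
        ((measure_mono fun y hy => (hBs hy).2).trans_lt measure_ball_lt_top)

theorem isOpenPosMeasure_riemannianVolume :
    (riemannianVolume n M).IsOpenPosMeasure := by
  refine ⟨fun O hO ⟨x, hxO⟩ h0 => ?_⟩
  have hso : IsOpen (O ∩ (extChartAt (𝓡 n) x).source) := hO.inter (isOpen_extChartAt_source x)
  have h1 := measure_mono_null (inter_subset_left (t := (extChartAt (𝓡 n) x).source)) h0
  rw [riemannianVolume_apply_of_subset x hso.measurableSet inter_subset_right] at h1
  have hAo : IsOpen ((extChartAt (𝓡 n) x).target ∩ (extChartAt (𝓡 n) x).symm ⁻¹'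
      (O ∩ (extChartAt (𝓡 n) x).source)) :=
    (continuousOn_extChartAt_symm x).isOpen_inter_preimage (isOpen_extChartAt_target x) hso
  have hxA : extChartAt (𝓡 n) x x ∈ (extChartAt (𝓡 n) x).target ∩ (extChartAt (𝓡 n) x).symm ⁻¹'
      (O ∩ (extChartAt (𝓡 n) x).source) :=
    ⟨mem_extChartAt_target x, by
      rw [mem_preimage, extChartAt_to_inv]; exact ⟨hxO, mem_extChartAt_source x⟩⟩
  rw [lintegral_eq_zero_iff' ((aemeasurable_chartDensity x).mono_measure
    (Measure.restrict_mono inter_subset_left le_rfl)), Filter.EventuallyEq,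
    ae_restrict_iff' hAo.measurableSet] at h1
  refine (hAo.measure_pos volume ⟨_, hxA⟩).ne' (measure_mono_null (fun y hy => ?_) h1)
  intro hy'
  have := ENNReal.ofReal_eq_zero.1 (hy' hy)
  exact absurd (sqrt_det_gram_pos x hy.1) (not_lt.2 this)

end Volume

/-! ### Integration by parts on `ℝⁿ` -/

section IntegrationByParts

variable {n p q : ℕ} {𝕜 : Type*} [RCLike 𝕜]

section Antisymmetrization

variable {W : Type*} [NormedAddCommGroup W] [NormedSpace ℝ W]

/-- In the antisymmetrisation of `A' ∧ b`, all summands of the alternatisation of `A'` contribute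
equally. -/
theorem wedgeSum_alternatizeUncurryFin_left (h : (p + 1) + q = n)
    (A' : W →L[ℝ] W [⋀^Fin p]→L[ℝ] 𝕜) (b : W [⋀^Fin q]→L[ℝ] 𝕜) (e : Fin n → W) :
    wedgeSum h (ContinuousAlternatingMap.alternatizeUncurryFin A') b e =
      ((p + 1 : ℕ) : 𝕜) * ∑ σ : Equiv.Perm (Fin n), ((Equiv.Perm.sign σ : ℤ) : 𝕜) *
        (A' (e (σ (leftIdx h 0))) (e ∘ σ ∘ leftIdx h ∘ Fin.succ) *
          (starRingEnd 𝕜) (b (e ∘ σ ∘ rightIdx h))) := by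
  have hterm : ∀ i : Fin (p + 1), ∑ σ : Equiv.Perm (Fin n), ((Equiv.Perm.sign σ : ℤ) : 𝕜) *
      (((-1 : 𝕜) ^ (i : ℕ) * A' ((e ∘ σ ∘ leftIdx h) i) (i.removeNth (e ∘ σ ∘ leftIdx h))) *
        (starRingEnd 𝕜) (b (e ∘ σ ∘ rightIdx h))) =
      ∑ σ : Equiv.Perm (Fin n), ((Equiv.Perm.sign σ : ℤ) : 𝕜) *
        (A' (e (σ (leftIdx h 0))) (e ∘ σ ∘ leftIdx h ∘ Fin.succ) *
          (starRingEnd 𝕜) (b (e ∘ σ ∘ rightIdx h))) := by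
    intro i
    -- reindexing by the cycle that moves the `i`-th argument to the front
    rw [← Equiv.sum_comp (Equiv.mulRight (leftPerm h i.cycleRange))]
    refine Finset.sum_congr rfl fun σ _ => ?_
    have e1 : e ∘ ⇑(σ * leftPerm h i.cycleRange) ∘ rightIdx h = e ∘ σ ∘ rightIdx h := by
      funext j; simp
    have e2 : (e ∘ ⇑(σ * leftPerm h i.cycleRange) ∘ leftIdx h) i = e (σ (leftIdx h 0)) := by
      simp
    have e3 : i.removeNth (e ∘ ⇑(σ * leftPerm h i.cycleRange) ∘ leftIdx h) =
        e ∘ σ ∘ leftIdx h ∘ Fin.succ := by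
      funext j; simp [Fin.removeNth]
    rw [Equiv.coe_mulRight, e1, e2, e3, map_mul, sign_leftPerm, Fin.sign_cycleRange]
    have hs : ((-1 : 𝕜) ^ (i : ℕ)) * (-1 : 𝕜) ^ (i : ℕ) = 1 := by
      rw [← mul_pow]; simp
    push_cast
    linear_combination (((Equiv.Perm.sign σ : ℤ) : 𝕜) *
        (A' (e (σ (leftIdx h 0))) (e ∘ σ ∘ leftIdx h ∘ Fin.succ) *
          (starRingEnd 𝕜) (b (e ∘ σ ∘ rightIdx h)))) * hs
  rw [wedgeSum]
  have hexp : ∀ v : Fin (p + 1) → W, ContinuousAlternatingMap.alternatizeUncurryFin A' v =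
      ∑ i : Fin (p + 1), (-1 : 𝕜) ^ (i : ℕ) * A' (v i) (i.removeNth v) := by
    intro v
    rw [ContinuousAlternatingMap.alternatizeUncurryFin_apply]
    refine Finset.sum_congr rfl fun i _ => ?_
    rw [zsmul_eq_mul]
    push_cast
    rfl
  simp only [hexp, Finset.sum_mul, Finset.mul_sum]
  rw [Finset.sum_comm]
  simp only [hterm]
  simp [Finset.mul_sum]

/-- The analogue of `wedgeSum_alternatizeUncurryFin_left` for `a ∧ B'`. The direction of
differentiation is moved past the `p` arguments of `a` to the front, which produces `(-1)ᵖ`; both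
sums then range over the same arrangements of arguments. -/
theorem wedgeSum_alternatizeUncurryFin_right (h : (p + 1) + q = n) (h' : p + (q + 1) = n)
    (a : W [⋀^Fin p]→L[ℝ] 𝕜) (B' : W →L[ℝ] W [⋀^Fin q]→L[ℝ] 𝕜) (e : Fin n → W) :
    wedgeSum h' a (ContinuousAlternatingMap.alternatizeUncurryFin B') e =
      ((q + 1 : ℕ) : 𝕜) * (-1) ^ p * ∑ σ : Equiv.Perm (Fin n), ((Equiv.Perm.sign σ : ℤ) : 𝕜) *
        (a (e ∘ σ ∘ leftIdx h ∘ Fin.succ) *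
          (starRingEnd 𝕜) (B' (e (σ (leftIdx h 0))) (e ∘ σ ∘ rightIdx h))) := by
  have c1 : ∀ j, leftIdx h' j = leftIdx h (Fin.castSucc j) := fun j => Fin.ext (by simp [leftIdx])
  have c2 : rightIdx h' 0 = leftIdx h (Fin.last p) := Fin.ext (by simp [leftIdx, rightIdx])
  have c3 : ∀ j, rightIdx h' (Fin.succ j) = rightIdx h j := fun j =>
    Fin.ext (by simp [rightIdx]; omega)
  have d1 : ∀ j : Fin p, (Fin.last p).cycleRange (Fin.castSucc j) = j.succ := fun j => by
    rw [← Fin.succAbove_last_apply, Fin.cycleRange_succAbove]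
  have hterm : ∀ i : Fin (q + 1), ∑ σ : Equiv.Perm (Fin n), ((Equiv.Perm.sign σ : ℤ) : 𝕜) *
      (a (e ∘ σ ∘ leftIdx h') * (starRingEnd 𝕜) ((-1 : 𝕜) ^ (i : ℕ) *
        B' ((e ∘ σ ∘ rightIdx h') i) (i.removeNth (e ∘ σ ∘ rightIdx h')))) =
      (-1) ^ p * ∑ σ : Equiv.Perm (Fin n), ((Equiv.Perm.sign σ : ℤ) : 𝕜) *
        (a (e ∘ σ ∘ leftIdx h ∘ Fin.succ) *
          (starRingEnd 𝕜) (B' (e (σ (leftIdx h 0))) (e ∘ σ ∘ rightIdx h))) := by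
    intro i
    rw [← Equiv.sum_comp (Equiv.mulRight
      (leftPerm h (Fin.last p).cycleRange * rightPerm h' i.cycleRange)), Finset.mul_sum]
    refine Finset.sum_congr rfl fun σ _ => ?_
    rw [Equiv.coe_mulRight]
    beta_reduce
    set ρ := σ * (leftPerm h (Fin.last p).cycleRange * rightPerm h' i.cycleRange) with hρ
    have e1 : e ∘ ⇑ρ ∘ leftIdx h' = e ∘ σ ∘ leftIdx h ∘ Fin.succ := by
      funext j
      change e (σ (leftPerm h _ (rightPerm h' _ (leftIdx h' j)))) = _
      rw [rightPerm_leftIdx, c1, leftPerm_leftIdx, d1]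
      rfl
    have e2 : (e ∘ ⇑ρ ∘ rightIdx h') i = e (σ (leftIdx h 0)) := by
      simp [hρ, c2]
    have e3 : i.removeNth (e ∘ ⇑ρ ∘ rightIdx h') = e ∘ σ ∘ rightIdx h := by
      funext j; simp [hρ, Fin.removeNth, c3]
    rw [e1, e2, e3, hρ, map_mul, map_mul, sign_leftPerm, sign_rightPerm, Fin.sign_cycleRange,
      Fin.sign_cycleRange, map_mul, map_pow, map_neg, map_one, Fin.val_last]
    have hs : ((-1 : 𝕜) ^ (i : ℕ)) * (-1 : 𝕜) ^ (i : ℕ) = 1 := by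
      rw [← mul_pow]; simp
    push_cast
    linear_combination ((-1 : 𝕜) ^ p * ((Equiv.Perm.sign σ : ℤ) : 𝕜) *
        (a (e ∘ σ ∘ leftIdx h ∘ Fin.succ) *
          (starRingEnd 𝕜) (B' (e (σ (leftIdx h 0))) (e ∘ σ ∘ rightIdx h)))) * hs
  rw [wedgeSum]
  have hexp : ∀ v : Fin (q + 1) → W, ContinuousAlternatingMap.alternatizeUncurryFin B' v =
      ∑ i : Fin (q + 1), (-1 : 𝕜) ^ (i : ℕ) * B' (v i) (i.removeNth v) := by
    intro v
    rw [ContinuousAlternatingMap.alternatizeUncurryFin_apply]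
    refine Finset.sum_congr rfl fun i _ => ?_
    rw [zsmul_eq_mul]
    push_cast
    rfl
  simp only [hexp, map_sum, Finset.mul_sum]
  rw [Finset.sum_comm]
  simp only [hterm]
  simp [Finset.mul_sum, mul_assoc]

end Antisymmetrization

theorem integrable_of_continuousOn {F : EuclideanSpace ℝ (Fin n) → 𝕜}
    {U K : Set (EuclideanSpace ℝ (Fin n))} (hF : ContinuousOn F U) (hK : IsCompact K)
    (hKU : K ⊆ U) (h0 : ∀ y, y ∉ K → F y = 0) : Integrable F := by
  rw [← integrableOn_iff_integrable_of_support_subset (s := K)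
    fun y hy => by_contra fun hyK => hy (h0 y hyK)]
  exact (hF.mono hKU).integrableOn_compact hK

/-- Stokes' theorem for the form `A ∧ B̄` with compact support, in the form of an integration by
parts. -/
theorem integral_wedgeSum_extDeriv (h : (p + 1) + q = n) (h' : p + (q + 1) = n)
    {A : EuclideanSpace ℝ (Fin n) → EuclideanSpace ℝ (Fin n) [⋀^Fin p]→L[ℝ] 𝕜}
    {B : EuclideanSpace ℝ (Fin n) → EuclideanSpace ℝ (Fin n) [⋀^Fin q]→L[ℝ] 𝕜}
    {U K : Set (EuclideanSpace ℝ (Fin n))} (hU : IsOpen U) (hK : IsCompact K) (hKU : K ⊆ U)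
    (hA : ContDiff ℝ 1 A) (hA0 : ∀ y, y ∉ K → A y = 0) (hB : ContDiffOn ℝ 1 B U)
    (e : Fin n → EuclideanSpace ℝ (Fin n)) :
    ((q + 1 : ℕ) : 𝕜) * ∫ y, wedgeSum h (extDeriv A y) (B y) e =
      (-1) ^ (p + 1) * ((p + 1 : ℕ) : 𝕜) * ∫ y, wedgeSum h' (A y) (extDeriv B y) e := by
  have hA0' : ∀ y, y ∉ K → fderiv ℝ A y = 0 := by
    intro y hy
    have : A =ᶠ[𝓝 y] fun _ => 0 := by
      filter_upwards [hK.isClosed.isOpen_compl.mem_nhds hy] with z hz using hA0 z hz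
    rw [this.fderiv_eq]
    simp
  have hAc : Continuous (fderiv ℝ A) := hA.continuous_fderiv one_ne_zero
  have hBc : ContinuousOn (fderiv ℝ B) U := hB.continuousOn_fderiv_of_isOpen hU le_rfl
  -- the products of components that occur, and their integrability
  have happ : ∀ {r : ℕ} {S : Set (EuclideanSpace ℝ (Fin n))}
      {C : EuclideanSpace ℝ (Fin n) → EuclideanSpace ℝ (Fin n) [⋀^Fin r]→L[ℝ] 𝕜}
      (_ : ContinuousOn C S) (u : Fin r → EuclideanSpace ℝ (Fin n)),
      ContinuousOn (fun y => C y u) S := fun hC u =>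
    (ContinuousAlternatingMap.apply ℝ (EuclideanSpace ℝ (Fin n)) 𝕜 u).continuous.comp_continuousOn hC
  have hconj : ∀ {S : Set (EuclideanSpace ℝ (Fin n))} {f : EuclideanSpace ℝ (Fin n) → 𝕜}
      (_ : ContinuousOn f S), ContinuousOn (fun y => (starRingEnd 𝕜) (f y)) S := fun hf =>
    RCLike.continuous_conj.comp_continuousOn hf
  have int1 : ∀ (v : EuclideanSpace ℝ (Fin n)) u w, Integrable
      (fun y => fderiv ℝ A y v u * (starRingEnd 𝕜) (B y w)) := fun v u w =>
    integrable_of_continuousOn ((happ (hAc.clm_apply continuous_const).continuousOn u).mul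
      (hconj (happ hB.continuousOn w))) hK hKU fun y hy => by simp [hA0' y hy]
  have int2 : ∀ (v : EuclideanSpace ℝ (Fin n)) u w, Integrable
      (fun y => A y u * (starRingEnd 𝕜) (fderiv ℝ B y v w)) := fun v u w =>
    integrable_of_continuousOn ((happ hA.continuous.continuousOn u).mul
      (hconj (happ (hBc.clm_apply continuousOn_const) w))) hK hKU fun y hy => by simp [hA0 y hy]
  have int3 : ∀ u w, Integrable
      (fun y => A y u * (starRingEnd 𝕜) (B y w)) := fun u w =>
    integrable_of_continuousOn ((happ hA.continuous.continuousOn u).mul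
      (hconj (happ hB.continuousOn w))) hK hKU fun y hy => by simp [hA0 y hy]
  have parts : ∀ (v : EuclideanSpace ℝ (Fin n)) u w,
      ∫ y, A y u * (starRingEnd 𝕜) (fderiv ℝ B y v w) =
        - ∫ y, fderiv ℝ A y v u * (starRingEnd 𝕜) (B y w) := by
    intro v u w
    refine integral_bilinear_hasFDerivAt_right_eq_neg_left_of_integrable (μ := volume) (v := v)
      (f := fun y => A y u) (g := fun y => (starRingEnd 𝕜) (B y w))
      (f' := fun y => (ContinuousAlternatingMap.apply ℝ (EuclideanSpace ℝ (Fin n)) 𝕜 u).comp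
        (fderiv ℝ A y))
      (g' := fun y => (RCLike.conjCLE (K := 𝕜)).toContinuousLinearMap.comp
        ((ContinuousAlternatingMap.apply ℝ (EuclideanSpace ℝ (Fin n)) 𝕜 w).comp (fderiv ℝ B y)))
      (B := ContinuousLinearMap.mul ℝ 𝕜) (int1 v u w) (int2 v u w) (int3 u w) ?_ ?_
    · intro y _
      exact (ContinuousAlternatingMap.apply ℝ (EuclideanSpace ℝ (Fin n)) 𝕜 u).hasFDerivAt.comp y
        (hA.differentiable one_ne_zero y).hasFDerivAt
    · intro y hy
      have hyK : y ∈ K := closure_minimal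
        (Function.support_subset_iff'.2 fun z hzK => by simp [hA0 z hzK]) hK.isClosed hy
      exact (RCLike.conjCLE (K := 𝕜)).toContinuousLinearMap.hasFDerivAt.comp y
        ((ContinuousAlternatingMap.apply ℝ (EuclideanSpace ℝ (Fin n)) 𝕜 w).hasFDerivAt.comp y
          ((hB.contDiffAt (hU.mem_nhds (hKU hyK))).differentiableAt one_ne_zero).hasFDerivAt)
  simp only [extDeriv, wedgeSum_alternatizeUncurryFin_left,
    wedgeSum_alternatizeUncurryFin_right h h']
  rw [integral_const_mul, integral_const_mul,
    integral_finsetSum _ fun σ _ => (int1 _ _ _).const_mul _,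
    integral_finsetSum _ fun σ _ => (int2 _ _ _).const_mul _]
  simp only [integral_const_mul, parts, mul_neg, Finset.sum_neg_distrib]
  have hs : ((-1 : 𝕜) ^ p) * (-1 : 𝕜) ^ p = 1 := by
    rw [← mul_pow]; simp
  rw [pow_succ]
  linear_combination (-((q + 1 : ℕ) : 𝕜) * ((p + 1 : ℕ) : 𝕜) *
    ∑ σ : Equiv.Perm (Fin n), ((Equiv.Perm.sign σ : ℤ) : 𝕜) *
      ∫ y, fderiv ℝ A y (e (σ (leftIdx h 0))) (e ∘ σ ∘ leftIdx h ∘ Fin.succ) *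
          (starRingEnd 𝕜) (B y (e ∘ σ ∘ rightIdx h))) * hs

end IntegrationByParts

/-! ### The Hodge star on forms and the operator `± ⋆⁻¹ d ⋆` -/

section Star

variable {n : ℕ} {𝕜 : Type*} [RCLike 𝕜]
variable {M : Type*} [TopologicalSpace M] [ChartedSpace (EuclideanSpace ℝ (Fin n)) M]

section Vanishing

theorem alternating_eq_zero_of_lt {W : Type*} [AddCommGroup W] [Module ℝ W] [TopologicalSpace W]
    (b : Basis (Fin n) ℝ W) {p : ℕ} (hp : n < p) (a : W [⋀^Fin p]→L[ℝ] 𝕜) : a = 0 := by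
  refine ContinuousAlternatingMap.toAlternatingMap_injective ?_
  refine Basis.ext_alternating b fun f hf => ?_
  have := Fintype.card_le_of_injective f hf
  simp at this
  omega

/-- There are no nonzero forms of degree larger than the dimension. -/
theorem smoothForm_eq_zero_of_lt {p : ℕ} (hp : n < p) (θ : SmoothForm n 𝕜 M p) : θ = 0 :=
  Subtype.ext (funext fun x =>
    alternating_eq_zero_of_lt (W := TangentSpace (𝓡 n) x) (stdB n) hp (θ.1 x))

theorem extDeriv_eq_zero {E F : Type*} [NormedAddCommGroup E] [NormedSpace ℝ E]
    [NormedAddCommGroup F] [NormedSpace ℝ F] {p : ℕ} {A : E → E [⋀^Fin p]→L[ℝ] F} {y : E}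
    (hA : A =ᶠ[𝓝 y] fun _ => 0) : extDeriv A y = 0 := by
  rw [hA.extDeriv_eq, extDeriv, fderiv_fun_const]
  ext v
  simp [ContinuousAlternatingMap.alternatizeUncurryFin_apply]

end Vanishing

variable [IsManifold (𝓡 n) ∞ M]

/-- The product of a smooth function and a form. -/
def mulForm {p : ℕ} (f : C^∞⟮𝓡 n, M; 𝓘(ℝ, ℝ), ℝ⟯) (θ : SmoothForm n 𝕜 M p) :
    SmoothForm n 𝕜 M p where
  val x := ((f x : ℝ) : 𝕜) • θ.1 x
  property := by
    intro c y hy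
    refine ContDiffAt.contDiffWithinAt ?_
    have h1 : ContDiffAt ℝ ∞ (fun z => f ((extChartAt (𝓡 n) c).symm z)) y :=
      (f.contMDiff.contMDiffAt.comp y (contMDiffAt_symm c hy)).contDiffAt
    have h2 : ContDiffAt ℝ ∞ (fun z => ((f ((extChartAt (𝓡 n) c).symm z) : ℝ) : 𝕜)) y :=
      (RCLike.ofRealCLM (K := 𝕜)).contDiff.contDiffAt.comp y h1
    refine contDiffAt_of_components fun g => ?_
    exact h2.mul (contDiffAt_apply_const (contDiffAt_localRep θ c hy) (stdB n ∘ g))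

theorem mulForm_apply {p : ℕ} (f : C^∞⟮𝓡 n, M; 𝓘(ℝ, ℝ), ℝ⟯) (θ : SmoothForm n 𝕜 M p) (x : M)
    (v : Fin p → TangentSpace (𝓡 n) x) : (mulForm f θ).1 x v = ((f x : ℝ) : 𝕜) * θ.1 x v := rfl

omit [IsManifold (𝓡 n) ∞ M] in
theorem extDerivAt_eq_zero {p : ℕ} {θ : ∀ x : M, TangentSpace (𝓡 n) x [⋀^Fin p]→L[ℝ] 𝕜} {x : M}
    (hθ : ∀ᶠ z in 𝓝 x, θ z = 0) : extDerivAt θ x = 0 := by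
  have h1 : localRep θ x =ᶠ[𝓝 (extChartAt (𝓡 n) x x)] fun _ => 0 := by
    have hc : ContinuousAt (extChartAt (𝓡 n) x).symm (extChartAt (𝓡 n) x x) :=
      continuousAt_extChartAt_symm x
    rw [ContinuousAt, extChartAt_to_inv] at hc
    filter_upwards [hc.eventually hθ] with y hy
    ext v
    rw [localRep_apply, hy]
    rfl
  rw [extDerivAt, extDeriv_eq_zero h1]
  rfl

omit [IsManifold (𝓡 n) ∞ M] in
theorem eventually_eq_zero_of_notMem_closure {p : ℕ}
    {θ : ∀ x : M, TangentSpace (𝓡 n) x [⋀^Fin p]→L[ℝ] 𝕜} {x : M}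
    (hx : x ∉ closure {x : M | θ x ≠ 0}) : ∀ᶠ z in 𝓝 x, θ z = 0 := by
  filter_upwards [isClosed_closure.isOpen_compl.mem_nhds hx] with z hz
  by_contra h
  exact hz (subset_closure h)

theorem extD_eq_zero_of_notMem {p : ℕ} {θ : SmoothForm n 𝕜 M p} {x : M}
    (hx : x ∉ closure {x : M | θ.1 x ≠ 0}) : (extD n 𝕜 M p θ).1 x = 0 :=
  extDerivAt_eq_zero (eventually_eq_zero_of_notMem_closure hx)

variable [RiemannianBundle (fun x : M => TangentSpace (𝓡 n) x)]

omit [IsManifold (𝓡 n) ∞ M] in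
/-- In a chart with volume form `s √(det g)`, the integrand of the `L²` product is the component
of `θ ∧ ⋆η̄`. -/
theorem wedgeSum_localRep {p q : ℕ} (o : ManifoldOrientation n M) (h : p + q = n)
    (θ η : ∀ x : M, TangentSpace (𝓡 n) x [⋀^Fin p]→L[ℝ] 𝕜) (c : M)
    (y : EuclideanSpace ℝ (Fin n)) {s : ℝ}
    (hs : (o.at_ ((extChartAt (𝓡 n) c).symm y)).volumeForm (paramDeriv c y ∘ stdB n) =
          s * Real.sqrt (gram c y).det) :
    wedgeSum h (localRep θ c y) (localRep (starFun o h η) c y) (stdB n) =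
      (p.factorial : 𝕜) * q.factorial * formInner (θ ((extChartAt (𝓡 n) c).symm y))
        (η ((extChartAt (𝓡 n) c).symm y)) * ((s * chartDensity c y : ℝ) : 𝕜) := by
  have := wedgeSum_hodgeStar (o.at_ ((extChartAt (𝓡 n) c).symm y)) h
    (θ ((extChartAt (𝓡 n) c).symm y)) (η ((extChartAt (𝓡 n) c).symm y))
    (paramDeriv c y ∘ stdB n)
  rw [hs] at this
  exact this

variable [IsContMDiffRiemannianBundle (𝓡 n) ∞ (EuclideanSpace ℝ (Fin n))
      (fun x : M => TangentSpace (𝓡 n) x)]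

/-- The pointwise inner product is continuous: in a chart it is the quotient of the smooth component
of `θ ∧ ⋆η̄` by that of the volume form. -/
theorem continuous_formInner {p q : ℕ} (o : ManifoldOrientation n M) (h : p + q = n)
    (θ η : SmoothForm n 𝕜 M p) : Continuous fun x => formInner (θ.1 x) (η.1 x) := by
  refine continuous_iff_continuousAt.2 fun c => ?_
  obtain ⟨s, hs, U, hUo, hcU, hUs, hU⟩ := exists_sign_volumeForm o c
  have hc := mem_extChartAt_target (I := 𝓡 n) c
  have hs0 : s ≠ 0 := by rcases hs with rfl | rfl <;> norm_num
  let G : EuclideanSpace ℝ (Fin n) → 𝕜 := fun y =>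
    wedgeSum h (localRep θ.1 c y) (localRep (starFun o h η.1) c y) (stdB n) /
      ((p.factorial : 𝕜) * q.factorial * ((s * chartDensity c y : ℝ) : 𝕜))
  have hG : ContinuousAt G (extChartAt (𝓡 n) c c) := by
    refine ContinuousAt.div ?_ ?_ ?_
    · simp only [wedgeSum]
      refine tendsto_finsetSum _ fun σ _ => Filter.Tendsto.mul tendsto_const_nhds
        (Filter.Tendsto.mul ?_ ((RCLike.continuous_conj.tendsto _).comp ?_))
      · exact (contDiffAt_apply_const (contDiffAt_localRep θ c hc) _).continuousAt
      · exact (contDiffAt_apply_const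
          (contDiffAt_localRep ⟨_, starFun_mem o h η⟩ c hc) _).continuousAt
    · exact continuousAt_const.mul (RCLike.continuous_ofReal.continuousAt.comp
        (continuousAt_const.mul (contDiffAt_sqrt_det_gram c hc).continuousAt))
    · refine mul_ne_zero (mul_ne_zero ?_ ?_) ?_
      · exact_mod_cast p.factorial_ne_zero
      · exact_mod_cast q.factorial_ne_zero
      · exact_mod_cast mul_ne_zero hs0 (sqrt_det_gram_pos c hc).ne'
  refine (hG.comp (continuousAt_extChartAt (I := 𝓡 n) c)).congr ?_
  filter_upwards [hUo.mem_nhds hcU] with x hx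
  have hxs := hUs hx
  have hxT := (extChartAt (𝓡 n) c).map_source hxs
  have hinv := (extChartAt (𝓡 n) c).left_inv hxs
  have key := wedgeSum_localRep o h θ.1 η.1 c _ (hU _ hxT (by rw [hinv]; exact hx))
  rw [hinv] at key
  simp only [Function.comp_apply, G]
  rw [key, div_eq_iff]
  · ring
  · refine mul_ne_zero (mul_ne_zero ?_ ?_) ?_
    · exact_mod_cast p.factorial_ne_zero
    · exact_mod_cast q.factorial_ne_zero
    · exact_mod_cast mul_ne_zero hs0 (sqrt_det_gram_pos c hxT).ne'

variable (𝕜) in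
/-- The Hodge star as a linear map on smooth forms. -/
def starMap {p q : ℕ} (o : ManifoldOrientation n M) (h : p + q = n) :
    SmoothForm n 𝕜 M p →ₗ[𝕜] SmoothForm n 𝕜 M q where
  toFun θ := ⟨starFun o h θ.1, starFun_mem o h θ⟩
  map_add' θ η := Subtype.ext (funext fun x => hodgeStar_add (o.at_ x) h (θ.1 x) (η.1 x))
  map_smul' k θ := Subtype.ext (funext fun x => hodgeStar_smul (o.at_ x) h k (θ.1 x))

theorem starMap_starMap {p q : ℕ} (o : ManifoldOrientation n M) (h : p + q = n) (h' : q + p = n)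
    (θ : SmoothForm n 𝕜 M p) :
    starMap 𝕜 o h' (starMap 𝕜 o h θ) = ((-1 : 𝕜) ^ (p * q)) • θ :=
  Subtype.ext (funext fun x => hodgeStar_hodgeStar (o.at_ x) h h' (θ.1 x))

/-- `⋆⁻¹ = (-1)^{pq} ⋆`. -/
def starInv {p q : ℕ} (o : ManifoldOrientation n M) (h : p + q = n) :
    SmoothForm n 𝕜 M q →ₗ[𝕜] SmoothForm n 𝕜 M p :=
  ((-1 : 𝕜) ^ (p * q)) • starMap 𝕜 o ((add_comm q p).trans h)

theorem neg_one_pow_mul_self (k : ℕ) : ((-1 : 𝕜) ^ k) * (-1) ^ k = 1 := by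
  rw [← mul_pow]; simp

variable (𝕜) in
/-- The Hodge star as an isomorphism. -/
def starEquiv {p q : ℕ} (o : ManifoldOrientation n M) (h : p + q = n) :
    SmoothForm n 𝕜 M p ≃ₗ[𝕜] SmoothForm n 𝕜 M q :=
  LinearEquiv.ofLinearMap (starMap 𝕜 o h) (starInv o h)
    (LinearMap.ext fun θ => by
      simp only [starInv, LinearMap.comp_apply, LinearMap.smul_apply, map_smul, starMap_starMap,
        smul_smul, LinearMap.id_apply]
      rw [mul_comm q p, neg_one_pow_mul_self, one_smul])
    (LinearMap.ext fun θ => by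
      simp only [starInv, LinearMap.comp_apply, LinearMap.smul_apply, starMap_starMap,
        smul_smul, LinearMap.id_apply]
      rw [neg_one_pow_mul_self, one_smul])

variable (𝕜) in
/-- The explicit codifferential `(-1)^{p+1} ⋆⁻¹ d ⋆ : Ωᵖ⁺¹ → Ωᵖ`. -/
def starCodiff {p q : ℕ} (o : ManifoldOrientation n M) (h : (p + 1) + q = n)
    (h' : p + (q + 1) = n) : SmoothForm n 𝕜 M (p + 1) →ₗ[𝕜] SmoothForm n 𝕜 M p :=
  ((-1 : 𝕜) ^ (p + 1)) • ((starEquiv 𝕜 o h').symm.toLinearMap ∘ₗ extD n 𝕜 M q ∘ₗ starMap 𝕜 o h)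

theorem starMap_starCodiff {p q : ℕ} (o : ManifoldOrientation n M) (h : (p + 1) + q = n)
    (h' : p + (q + 1) = n) (η : SmoothForm n 𝕜 M (p + 1)) :
    starMap 𝕜 o h' (starCodiff 𝕜 o h h' η) =
      ((-1 : 𝕜) ^ (p + 1)) • extD n 𝕜 M q (starMap 𝕜 o h η) := by
  rw [starCodiff, LinearMap.smul_apply, map_smul]
  congr 1
  exact (starEquiv 𝕜 o h').apply_symm_apply _

end Star

/-! ### The operator `± ⋆⁻¹ d ⋆` is the formal adjoint of `d` -/

section Adjoint

variable {n : ℕ} {𝕜 : Type*} [RCLike 𝕜]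
variable {M : Type*} [TopologicalSpace M]
variable [ChartedSpace (EuclideanSpace ℝ (Fin n)) M]
variable [IsManifold (𝓡 n) ∞ M]

/-- A compactly supported form is a finite sum of forms with compact supports in the sets of a given
open cover, cut out by a partition of unity. -/
theorem exists_finset_sum_mulForm [T2Space M] [SigmaCompactSpace M] {p : ℕ} (θ : SmoothForm n 𝕜 M p)
    (hθ : HasCompactSupp θ) (U : M → Set M) (hUo : ∀ c, IsOpen (U c)) (hcU : ∀ c, c ∈ U c) :
    ∃ (t : Finset M) (Θ : M → SmoothForm n 𝕜 M p), θ = ∑ c ∈ t, Θ c ∧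
      ∀ c, HasCompactSupp (Θ c) ∧ closure {x : M | (Θ c).1 x ≠ 0} ⊆ U c := by
  obtain ⟨ρ, hρ⟩ := SmoothPartitionOfUnity.exists_isSubordinate (𝓡 n)
    (isClosed_closure (s := {x : M | θ.1 x ≠ 0})) U hUo
    (fun x _ => mem_iUnion.2 ⟨x, hcU x⟩)
  have hfin := ρ.locallyFinite.finite_nonempty_inter_compact hθ
  refine ⟨hfin.toFinset, fun c => mulForm (ρ c) θ, ?_, fun c => ?_⟩
  · refine Subtype.ext (funext fun x => ContinuousAlternatingMap.ext fun v => ?_)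
    let ev : SmoothForm n 𝕜 M p →+ 𝕜 :=
      { toFun := fun θ => θ.1 x v, map_zero' := rfl, map_add' := fun _ _ => rfl }
    have hsum : (∑ c ∈ hfin.toFinset, mulForm (ρ c) θ).1 x v =
        (∑ c ∈ hfin.toFinset, ((ρ c x : ℝ) : 𝕜)) * θ.1 x v := by
      rw [Finset.sum_mul]
      exact map_sum ev _ _
    rw [hsum]
    by_cases hx : θ.1 x = 0
    · rw [hx]
      exact (mul_zero _).symm
    · have hxK : x ∈ closure {x : M | θ.1 x ≠ 0} := subset_closure hx
      have h1 := ρ.sum_eq_one hxK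
      rw [finsum_eq_sum_of_support_subset (s := hfin.toFinset) _ (fun c hc => by
        rw [Finset.mem_coe, Set.Finite.mem_toFinset]
        exact ⟨x, hc, hxK⟩)] at h1
      rw [← RCLike.ofReal_sum, h1, RCLike.ofReal_one, one_mul]
  · have hsub : {x : M | (mulForm (ρ c) θ).1 x ≠ 0} ⊆
        {x : M | θ.1 x ≠ 0} ∩ Function.support (ρ c) := by
      intro x hx
      refine ⟨fun h0 => hx ?_, fun h0 => hx ?_⟩
      · ext v
        rw [mulForm_apply, h0]
        exact mul_zero _
      · ext v
        rw [mulForm_apply, h0, RCLike.ofReal_zero, zero_mul]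
        rfl
    exact ⟨IsCompact.of_isClosed_subset hθ isClosed_closure
      (closure_mono (hsub.trans inter_subset_left)),
      (closure_mono (hsub.trans inter_subset_right)).trans (hρ c)⟩

variable [RiemannianBundle (fun x : M => TangentSpace (𝓡 n) x)]
variable [IsContMDiffRiemannianBundle (𝓡 n) ∞ (EuclideanSpace ℝ (Fin n))
      (fun x : M => TangentSpace (𝓡 n) x)]
variable [MeasurableSpace M] [BorelSpace M]

theorem integrable_formInner [T2Space M] {p q : ℕ} (o : ManifoldOrientation n M) (h : p + q = n)
    (θ η : SmoothForm n 𝕜 M p) {K : Set M} (hK : IsCompact K) (hθ : ∀ x, x ∉ K → θ.1 x = 0) :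
    Integrable (fun x => formInner (θ.1 x) (η.1 x)) (riemannianVolume n M) := by
  have : IsLocallyFiniteMeasure (riemannianVolume n M) := isLocallyFiniteMeasure_riemannianVolume
  exact (continuous_formInner o h θ η).integrable_of_hasCompactSupport
    (HasCompactSupport.intro hK fun x hx => by rw [hθ x hx, formInner_zero_left])

/-- The adjunction for forms supported where the orientation is constant in a chart: both sides are
integrals over `ℝⁿ`, related by integration by parts. -/
theorem l2Inner_extD_of_subset {p q : ℕ} (o : ManifoldOrientation n M) (h : (p + 1) + q = n)
    (h' : p + (q + 1) = n) (c : M) {s : ℝ} {U : Set M}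
    (hUs : U ⊆ (extChartAt (𝓡 n) c).source) (hs : s = 1 ∨ s = -1)
    (hU : ∀ y ∈ (extChartAt (𝓡 n) c).target, (extChartAt (𝓡 n) c).symm y ∈ U →
      (o.at_ ((extChartAt (𝓡 n) c).symm y)).volumeForm (paramDeriv c y ∘ stdB n) =
          s * Real.sqrt (gram c y).det)
    (θ : SmoothForm n 𝕜 M p) (η : SmoothForm n 𝕜 M (p + 1)) (hθ : HasCompactSupp θ)
    (hθU : closure {x : M | θ.1 x ≠ 0} ⊆ U) :
    l2Inner (extD n 𝕜 M p θ) η = l2Inner θ (starCodiff 𝕜 o h h' η) := by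
  set φ := extChartAt (𝓡 n) c with hφ
  set K₀ := closure {x : M | θ.1 x ≠ 0} with hK₀
  set K := φ '' K₀ with hKdef
  have hs2 : (s : 𝕜) * (s : 𝕜) = 1 := by rcases hs with rfl | rfl <;> simp
  have hK : IsCompact K := IsCompact.image_of_continuousOn hθ
    ((continuousOn_extChartAt c).mono (hθU.trans hUs))
  have hKT : K ⊆ φ.target := by
    rintro _ ⟨x, hx, rfl⟩
    exact φ.map_source (hUs (hθU hx))
  have hKsymm : ∀ y ∈ φ.target, y ∉ K → φ.symm y ∉ K₀ := fun y hy hyK hx =>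
    hyK ⟨_, hx, φ.right_inv hy⟩
  have hθ0 : ∀ x, x ∉ K₀ → θ.1 x = 0 := fun x hx => by_contra fun hne => hx (subset_closure hne)
  -- the coordinate expressions of `θ`, extended by zero, and of `⋆η`
  let A : EuclideanSpace ℝ (Fin n) → EuclideanSpace ℝ (Fin n) [⋀^Fin p]→L[ℝ] 𝕜 :=
    φ.target.indicator (localRep θ.1 c)
  let B : EuclideanSpace ℝ (Fin n) → EuclideanSpace ℝ (Fin n) [⋀^Fin q]→L[ℝ] 𝕜 :=
    localRep (starMap 𝕜 o h η).1 c
  have hTo : IsOpen φ.target := isOpen_extChartAt_target c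
  have hAloc : ∀ y ∈ φ.target, A =ᶠ[𝓝 y] localRep θ.1 c := by
    intro y hy
    filter_upwards [hTo.mem_nhds hy] with z hz using indicator_of_mem hz _
  have hA0 : ∀ y, y ∉ K → A y = 0 := by
    intro y hy
    by_cases hyT : y ∈ φ.target
    · rw [(hAloc y hyT).eq_of_nhds]
      ext v
      rw [localRep_apply, hθ0 _ (hKsymm y hyT hy)]
      rfl
    · exact indicator_of_notMem hyT _
  have hA0loc : ∀ y, y ∉ K → A =ᶠ[𝓝 y] fun _ => 0 := by
    intro y hy
    filter_upwards [hK.isClosed.isOpen_compl.mem_nhds hy] with z hz using hA0 z hz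
  have hA : ContDiff ℝ 1 A := by
    refine contDiff_iff_contDiffAt.2 fun y => ?_
    by_cases hyK : y ∈ K
    · exact ((contDiffAt_localRep θ c (hKT hyK)).of_le (by simp)).congr_of_eventuallyEq
        (hAloc y (hKT hyK))
    · exact contDiffAt_const.congr_of_eventuallyEq (hA0loc y hyK)
  have hB : ContDiffOn ℝ 1 B φ.target := ((starMap 𝕜 o h η).2 c).of_le (by simp)
  have hparts := integral_wedgeSum_extDeriv h h' hTo hK hKT hA hA0 hB (stdB n)
  have hp : (p.factorial : 𝕜) ≠ 0 := by exact_mod_cast p.factorial_ne_zero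
  have hq : (q.factorial : 𝕜) ≠ 0 := by exact_mod_cast q.factorial_ne_zero
  have hp1 : ((p + 1 : ℕ) : 𝕜) ≠ 0 := by exact_mod_cast p.succ_ne_zero
  have hq1 : ((q + 1 : ℕ) : 𝕜) ≠ 0 := by exact_mod_cast q.succ_ne_zero
  -- the factorials are those in the definition of `wedgeSum`
  have hleft : (((p + 1).factorial : 𝕜) * q.factorial) * l2Inner (extD n 𝕜 M p θ) η =
      (s : 𝕜) * ∫ y, wedgeSum h (extDeriv A y) (B y) (stdB n) := by
    rw [l2Inner, integral_riemannianVolume c (continuous_formInner o h _ _) (fun x hx => by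
      rw [extD_eq_zero_of_notMem fun hxK => hx (hUs (hθU hxK)), formInner_zero_left]),
      ← setIntegral_eq_integral_of_forall_compl_eq_zero (s := φ.target) (μ := volume)
        (f := fun y => wedgeSum h (extDeriv A y) (B y) (stdB n)) (fun y hy => by
          rw [extDeriv_eq_zero (hA0loc y fun hyK => hy (hKT hyK))]
          simp [wedgeSum]), ← integral_const_mul, ← integral_const_mul]
    refine setIntegral_congr_fun hTo.measurableSet fun y hy => ?_
    beta_reduce
    by_cases hyK : y ∈ K
    · have hyU : φ.symm y ∈ U := by
        obtain ⟨x, hx, rfl⟩ := hyK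
        rw [φ.left_inv (hUs (hθU hx))]
        exact hθU hx
      have key := wedgeSum_localRep o h (extDerivAt θ.1) η.1 c y (hU y hy hyU)
      rw [(hAloc y hy).extDeriv_eq, ← localRep_extDerivAt θ c hy]
      refine Eq.trans ?_ (congrArg (fun t => (s : 𝕜) * t) key.symm)
      rw [RCLike.real_smul_eq_coe_mul, RCLike.ofReal_mul]
      change _ * (_ * formInner (extDerivAt θ.1 (φ.symm y)) (η.1 (φ.symm y))) = _
      linear_combination (-(((p + 1).factorial : 𝕜) * q.factorial) * (chartDensity c y : 𝕜) *
        formInner (extDerivAt θ.1 (φ.symm y)) (η.1 (φ.symm y))) * hs2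
    · rw [extD_eq_zero_of_notMem (hKsymm y hy hyK), extDeriv_eq_zero (hA0loc y hyK),
        formInner_zero_left]
      simp [wedgeSum]
  have hright : ((p.factorial : 𝕜) * (q + 1).factorial) * l2Inner θ (starCodiff 𝕜 o h h' η) =
      (s : 𝕜) * ((-1) ^ (p + 1) * ∫ y, wedgeSum h' (A y) (extDeriv B y) (stdB n)) := by
    rw [l2Inner, integral_riemannianVolume c (continuous_formInner o h' _ _) (fun x hx => by
      rw [hθ0 x fun hxK => hx (hUs (hθU hxK)), formInner_zero_left]),
      ← setIntegral_eq_integral_of_forall_compl_eq_zero (s := φ.target) (μ := volume)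
        (f := fun y => wedgeSum h' (A y) (extDeriv B y) (stdB n)) (fun y hy => by
          rw [hA0 y fun hyK => hy (hKT hyK)]
          simp [wedgeSum]), ← integral_const_mul, ← integral_const_mul, ← integral_const_mul]
    refine setIntegral_congr_fun hTo.measurableSet fun y hy => ?_
    beta_reduce
    by_cases hyK : y ∈ K
    · have hyU : φ.symm y ∈ U := by
        obtain ⟨x, hx, rfl⟩ := hyK
        rw [φ.left_inv (hUs (hθU hx))]
        exact hθU hx
      have key := wedgeSum_localRep o h' θ.1 (starCodiff 𝕜 o h h' η).1 c y (hU y hy hyU)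
      have hstar : localRep (starFun o h' (starCodiff 𝕜 o h h' η).1) c y =
          ((-1 : 𝕜) ^ (p + 1)) • extDeriv B y := by
        have h1 : starFun o h' (starCodiff 𝕜 o h h' η).1 =
            ((-1 : 𝕜) ^ (p + 1)) • extDerivAt (starMap 𝕜 o h η).1 :=
          congrArg Subtype.val (starMap_starCodiff o h h' η)
        rw [h1, ← localRep_extDerivAt (starMap 𝕜 o h η) c hy]
        rfl
      have hconj : wedgeSum h' (localRep θ.1 c y) (((-1 : 𝕜) ^ (p + 1)) • extDeriv B y) (stdB n) =
          (-1) ^ (p + 1) * wedgeSum h' (localRep θ.1 c y) (extDeriv B y) (stdB n) := by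
        simp only [wedgeSum, Finset.mul_sum, ContinuousAlternatingMap.smul_apply, smul_eq_mul,
          map_mul, map_pow, map_neg, map_one]
        refine Finset.sum_congr rfl fun σ _ => ?_
        ring
      rw [(hAloc y hy).eq_of_nhds, ← hconj, ← hstar]
      refine Eq.trans ?_ (congrArg (fun t => (s : 𝕜) * t) key.symm)
      rw [RCLike.real_smul_eq_coe_mul, RCLike.ofReal_mul]
      linear_combination (-((p.factorial : 𝕜) * (q + 1).factorial) * (chartDensity c y : 𝕜) *
        formInner (θ.1 (φ.symm y)) ((starCodiff 𝕜 o h h' η).1 (φ.symm y))) * hs2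
    · rw [hθ0 _ (hKsymm y hy hyK), hA0 y hyK, formInner_zero_left]
      simp [wedgeSum]
  have hne : ((p + 1).factorial : 𝕜) * ((q + 1).factorial : 𝕜) ≠ 0 :=
    mul_ne_zero (by exact_mod_cast (p + 1).factorial_ne_zero)
      (by exact_mod_cast (q + 1).factorial_ne_zero)
  refine mul_left_cancel₀ hne ?_
  rw [Nat.factorial_succ] at hleft hright ⊢
  rw [Nat.factorial_succ q]
  push_cast at hleft hright hparts ⊢
  linear_combination ((q : 𝕜) + 1) * hleft - ((p : 𝕜) + 1) * hright + (s : 𝕜) * hparts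

variable [T2Space M]

theorem isFormalAdjoint_starCodiff [SigmaCompactSpace M] {p q : ℕ} (o : ManifoldOrientation n M)
    (h : (p + 1) + q = n) (h' : p + (q + 1) = n) :
    IsFormalAdjoint (starCodiff 𝕜 o h h' : SmoothForm n 𝕜 M (p + 1) →ₗ[𝕜] SmoothForm n 𝕜 M p) := by
  intro θ η hθ
  choose s hs U hUo hcU hUs hU using exists_sign_volumeForm (M := M) o
  obtain ⟨t, Θ, hΘ, hΘc⟩ := exists_finset_sum_mulForm θ hθ U hUo hcU
  have hcomp : ∀ c, ∀ x, x ∉ closure {x : M | (Θ c).1 x ≠ 0} → (Θ c).1 x = 0 := fun c x hx =>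
    by_contra fun hne => hx (subset_closure hne)
  have e1 : l2Inner (extD n 𝕜 M p θ) η = ∑ c ∈ t, l2Inner (extD n 𝕜 M p (Θ c)) η := by
    simp only [l2Inner]
    rw [← integral_finsetSum _ fun c _ => integrable_formInner o h _ η (hΘc c).1
      fun x hx => extD_eq_zero_of_notMem hx]
    refine integral_congr_ae (Filter.Eventually.of_forall fun x => ?_)
    beta_reduce
    rw [← formInner_sum_left, hΘ, map_sum, AddSubmonoidClass.coe_finsetSum, Finset.sum_apply]
  have e2 : l2Inner θ (starCodiff 𝕜 o h h' η) =
      ∑ c ∈ t, l2Inner (Θ c) (starCodiff 𝕜 o h h' η) := by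
    simp only [l2Inner]
    rw [← integral_finsetSum _ fun c _ => integrable_formInner o h' _ _ (hΘc c).1 (hcomp c)]
    refine integral_congr_ae (Filter.Eventually.of_forall fun x => ?_)
    beta_reduce
    rw [← formInner_sum_left]
    conv_lhs => rw [hΘ]
    rw [AddSubmonoidClass.coe_finsetSum, Finset.sum_apply]
  rw [e1, e2]
  exact Finset.sum_congr rfl fun c _ => l2Inner_extD_of_subset o h h' c (hUs c) (hs c) (hU c)
    (Θ c) η (hΘc c).1 (hΘc c).2

/-- Formal adjoints are unique, because the `L²` product with compactly supported forms separates
forms. -/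
theorem isFormalAdjoint_unique {p q : ℕ} (o : ManifoldOrientation n M) (h : p + q = n)
    {δ δ' : SmoothForm n 𝕜 M (p + 1) →ₗ[𝕜] SmoothForm n 𝕜 M p}
    (hδ : IsFormalAdjoint δ) (hδ' : IsFormalAdjoint δ') : δ = δ' := by
  have : IsLocallyFiniteMeasure (riemannianVolume n M) := isLocallyFiniteMeasure_riemannianVolume
  have : (riemannianVolume n M).IsOpenPosMeasure := isOpenPosMeasure_riemannianVolume
  refine LinearMap.ext fun η => sub_eq_zero.1 (Subtype.ext (funext fun x₀ => ?_))
  set ξ : SmoothForm n 𝕜 M p := δ η - δ' η with hξ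
  change ξ.1 x₀ = 0
  by_contra hne
  -- the test form is `f ξ`, for which `⟨f ξ, ξ⟩ = f |ξ|²` is nonnegative and positive at `x₀`
  obtain ⟨f⟩ : Nonempty (SmoothBumpFunction (𝓡 n) x₀) := inferInstance
  let F : C^∞⟮𝓡 n, M; 𝓘(ℝ, ℝ), ℝ⟯ := ⟨f, f.contMDiff⟩
  have hcs : ∀ x, x ∉ tsupport f → (mulForm F ξ).1 x = 0 := by
    intro x hx
    ext v
    rw [mulForm_apply, show F x = 0 from image_eq_zero_of_notMem_tsupport hx, RCLike.ofReal_zero,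
      zero_mul]
    rfl
  have hcomp : HasCompactSupp (mulForm F ξ) :=
    IsCompact.of_isClosed_subset f.hasCompactSupport isClosed_closure
      (closure_minimal (fun x hx => by_contra fun hxf => hx (hcs x hxf)) (isClosed_tsupport _))
  have h0 : ∫ x, formInner ((mulForm F ξ).1 x) (ξ.1 x) ∂(riemannianVolume n M) = 0 := by
    have h1 : l2Inner (mulForm F ξ) (δ η) = l2Inner (mulForm F ξ) (δ' η) :=
      (hδ _ η hcomp).symm.trans (hδ' _ η hcomp)
    have h2 : ∀ x, formInner ((mulForm F ξ).1 x) (ξ.1 x) =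
        formInner ((mulForm F ξ).1 x) ((δ η).1 x) - formInner ((mulForm F ξ).1 x) ((δ' η).1 x) :=
      fun x => formInner_sub_right _ _ _
    simp only [h2]
    rw [integral_sub (integrable_formInner o h _ _ f.hasCompactSupport hcs)
      (integrable_formInner o h _ _ f.hasCompactSupport hcs)]
    exact sub_eq_zero.2 h1
  have hval : ∀ x, RCLike.re (formInner ((mulForm F ξ).1 x) (ξ.1 x)) =
      f x * RCLike.re (formInner (ξ.1 x) (ξ.1 x)) := by
    intro x
    change RCLike.re (formInner (((f x : ℝ) : 𝕜) • ξ.1 x) (ξ.1 x)) = _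
    rw [formInner_smul_left, RCLike.re_ofReal_mul]
  have hpos : 0 < ∫ x, RCLike.re (formInner ((mulForm F ξ).1 x) (ξ.1 x))
      ∂(riemannianVolume n M) := by
    refine Continuous.integral_pos_of_hasCompactSupport_nonneg_nonzero (x := x₀)
      (RCLike.continuous_re.comp (continuous_formInner o h (mulForm F ξ) ξ))
      (HasCompactSupport.intro f.hasCompactSupport fun x hx => ?_) (fun x => ?_) ?_
    · rw [hcs x hx, formInner_zero_left, map_zero]
    · rw [hval]
      exact mul_nonneg f.nonneg (re_formInner_self_nonneg _)
    · rw [hval, f.eq_one, one_mul]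
      exact fun h00 => hne (eq_zero_of_formInner_self _ h00)
  rw [integral_re (integrable_formInner o h _ _ f.hasCompactSupport hcs), h0, map_zero] at hpos
  exact lt_irrefl _ hpos

end Adjoint

/-! ### Conjugating the generalized Hodge Laplacian by the Hodge star -/

section Conjugation

variable {n : ℕ} {𝕜 : Type*} [RCLike 𝕜]
variable {M : Type*} [TopologicalSpace M] [T2Space M] [SigmaCompactSpace M]
variable [ChartedSpace (EuclideanSpace ℝ (Fin n)) M]
variable [IsManifold (𝓡 n) ∞ M]
variable [RiemannianBundle (fun x : M => TangentSpace (𝓡 n) x)]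
variable [IsContMDiffRiemannianBundle (𝓡 n) ∞ (EuclideanSpace ℝ (Fin n))
      (fun x : M => TangentSpace (𝓡 n) x)]
variable [MeasurableSpace M] [BorelSpace M]

omit [T2Space M] [SigmaCompactSpace M] [IsContMDiffRiemannianBundle (𝓡 n) ∞
  (EuclideanSpace ℝ (Fin n)) (fun x : M => TangentSpace (𝓡 n) x)] [BorelSpace M] in
theorem genHodge_zero_apply (α β : ℝ) (θ : SmoothForm n 𝕜 M 0) :
    genHodge n 𝕜 M α β 0 θ = (β : 𝕜) • codiff n 𝕜 M 0 (extD n 𝕜 M 0 θ) := rfl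

omit [T2Space M] [SigmaCompactSpace M] [IsContMDiffRiemannianBundle (𝓡 n) ∞
  (EuclideanSpace ℝ (Fin n)) (fun x : M => TangentSpace (𝓡 n) x)] [BorelSpace M] in
theorem genHodge_succ_apply (α β : ℝ) {p : ℕ} (θ : SmoothForm n 𝕜 M (p + 1)) :
    genHodge n 𝕜 M α β (p + 1) θ = (α : 𝕜) • extD n 𝕜 M p (codiff n 𝕜 M p θ) +
      (β : 𝕜) • codiff n 𝕜 M (p + 1) (extD n 𝕜 M (p + 1) θ) := rfl

/-- The codifferential is a formal adjoint of `d` in every degree, including the degrees above the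
dimension, where all forms vanish. -/
theorem isFormalAdjoint_codiff (o : ManifoldOrientation n M) (p : ℕ) :
    IsFormalAdjoint (codiff n 𝕜 M p) := by
  have hex : ∃ δ : SmoothForm n 𝕜 M (p + 1) →ₗ[𝕜] SmoothForm n 𝕜 M p, IsFormalAdjoint δ := by
    by_cases hp : p + 1 ≤ n
    · obtain ⟨q, hq⟩ := Nat.exists_eq_add_of_le hp
      exact ⟨_, isFormalAdjoint_starCodiff o (q := q) (by omega) (by omega)⟩
    · refine ⟨0, fun θ η _ => ?_⟩
      rw [smoothForm_eq_zero_of_lt (by omega) η, map_zero]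
      exact integral_congr_ae (Filter.Eventually.of_forall fun x =>
        (formInner_zero_right _).trans (formInner_zero_right _).symm)
  rw [codiff, dif_pos hex]
  exact hex.choose_spec

theorem codiff_eq_starCodiff {p q : ℕ} (o : ManifoldOrientation n M) (h : (p + 1) + q = n)
    (h' : p + (q + 1) = n) : codiff n 𝕜 M p = starCodiff 𝕜 o h h' :=
  isFormalAdjoint_unique o h' (isFormalAdjoint_codiff o p) (isFormalAdjoint_starCodiff o h h')

/-- `⋆δ = (-1)^{p+1} d⋆`. -/
theorem starMap_codiff {p q : ℕ} (o : ManifoldOrientation n M) (h : (p + 1) + q = n)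
    (h' : p + (q + 1) = n) (η : SmoothForm n 𝕜 M (p + 1)) :
    starMap 𝕜 o h' (codiff n 𝕜 M p η) =
      ((-1 : 𝕜) ^ (p + 1)) • extD n 𝕜 M q (starMap 𝕜 o h η) := by
  rw [codiff_eq_starCodiff o h h', starMap_starCodiff]

/-- `δ⋆ = (-1)^{p+1} ⋆d`. -/
theorem codiff_starMap {p q : ℕ} (o : ManifoldOrientation n M) (h : (p + 1) + q = n)
    (h' : p + (q + 1) = n) (θ : SmoothForm n 𝕜 M p) :
    codiff n 𝕜 M q (starMap 𝕜 o h' θ) =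
      ((-1 : 𝕜) ^ (p + 1)) • starMap 𝕜 o h (extD n 𝕜 M p θ) := by
  have e : q + (p + 1) = n := by omega
  -- applying the star to both sides turns this into `starMap_codiff` and `⋆⋆ = ±1`
  have hinj : Function.Injective (starMap 𝕜 o e : SmoothForm n 𝕜 M q →ₗ[𝕜] _) :=
    (starEquiv 𝕜 o e).injective
  apply hinj
  rw [starMap_codiff o (show (q + 1) + p = n by omega) e, starMap_starMap, map_smul, map_smul,
    starMap_starMap, smul_smul, smul_smul, ← pow_add, ← pow_add]
  congr 2
  ring

/-- `⋆ δ d = d δ ⋆`: both sides are `(-1)^{p+1} d ⋆ d`. -/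
theorem starMap_codiff_extD {p q : ℕ} (o : ManifoldOrientation n M) (h : p + (q + 1) = n)
    (θ : SmoothForm n 𝕜 M p) :
    starMap 𝕜 o h (codiff n 𝕜 M p (extD n 𝕜 M p θ)) =
      extD n 𝕜 M q (codiff n 𝕜 M q (starMap 𝕜 o h θ)) := by
  rw [starMap_codiff o (by omega) h, codiff_starMap o (by omega) h, map_smul]

/-- `⋆ d δ = δ d ⋆`: both sides are `(-1)^{p+1} δ ⋆ δ`. -/
theorem starMap_extD_codiff {p q : ℕ} (o : ManifoldOrientation n M) (h : (p + 1) + q = n)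
    (θ : SmoothForm n 𝕜 M (p + 1)) :
    starMap 𝕜 o h (extD n 𝕜 M p (codiff n 𝕜 M p θ)) =
      codiff n 𝕜 M q (extD n 𝕜 M q (starMap 𝕜 o h θ)) := by
  have h1 := codiff_starMap o h (by omega) (codiff n 𝕜 M p θ)
  rw [starMap_codiff o h (by omega), map_smul] at h1
  have hu : ((-1 : 𝕜) ^ (p + 1)) ≠ 0 := pow_ne_zero _ (by simp)
  exact (smul_right_injective _ hu h1).symm

omit [T2Space M] [SigmaCompactSpace M] [IsContMDiffRiemannianBundle (𝓡 n) ∞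
  (EuclideanSpace ℝ (Fin n)) (fun x : M => TangentSpace (𝓡 n) x)] [BorelSpace M] in
theorem codiff_extD_eq_zero_of_le {p : ℕ} (hp : n ≤ p) (θ : SmoothForm n 𝕜 M p) :
    codiff n 𝕜 M p (extD n 𝕜 M p θ) = 0 :=
  (congrArg (codiff n 𝕜 M p) (smoothForm_eq_zero_of_lt (by omega) (extD n 𝕜 M p θ))).trans
    (codiff n 𝕜 M p).map_zero

/-- The Hodge star interchanges the two summands of the operator. -/
theorem starMap_genHodge {p q : ℕ} (o : ManifoldOrientation n M) (h : p + q = n) (α β : ℝ)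
    (θ : SmoothForm n 𝕜 M p) :
    starMap 𝕜 o h (genHodge n 𝕜 M α β p θ) = genHodge n 𝕜 M β α q (starMap 𝕜 o h θ) := by
  -- in degree `0` only one summand is present; its counterpart in degree `n` is the one with
  -- a form of degree `n + 1`, which is zero
  rcases p with _ | p <;> rcases q with _ | q
  · have h1 := codiff_extD_eq_zero_of_le (by omega) θ
    have h2 := codiff_extD_eq_zero_of_le (by omega) (starMap 𝕜 o h θ)
    have e1 : genHodge n 𝕜 M α β 0 θ = 0 :=
      (congrArg ((β : 𝕜) • ·) h1).trans (smul_zero _)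
    have e2 : genHodge n 𝕜 M β α 0 (starMap 𝕜 o h θ) = 0 :=
      (congrArg ((α : 𝕜) • ·) h2).trans (smul_zero _)
    exact (congrArg (starMap 𝕜 o h) e1).trans ((starMap 𝕜 o h).map_zero.trans e2.symm)
  · have h1 := starMap_codiff_extD o h θ
    have h2 := codiff_extD_eq_zero_of_le (by omega) (starMap 𝕜 o h θ)
    refine (congrArg (starMap 𝕜 o h) (genHodge_zero_apply α β θ)).trans ?_
    refine ((starMap 𝕜 o h).map_smul (β : 𝕜) _).trans ?_
    refine Eq.trans ?_ (genHodge_succ_apply β α (starMap 𝕜 o h θ)).symm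
    rw [h1, h2]
    exact (add_zero _).symm.trans (congrArg _ (smul_zero _).symm)
  · have h1 := starMap_extD_codiff o h θ
    have h2 := codiff_extD_eq_zero_of_le (by omega) θ
    have e1 : genHodge n 𝕜 M α β (p + 1) θ = (α : 𝕜) • extD n 𝕜 M p (codiff n 𝕜 M p θ) := by
      refine (genHodge_succ_apply α β θ).trans ?_
      rw [h2]
      exact (congrArg _ (smul_zero _)).trans (add_zero _)
    refine (congrArg (starMap 𝕜 o h) e1).trans ?_
    refine ((starMap 𝕜 o h).map_smul (α : 𝕜) _).trans ?_
    exact congrArg ((α : 𝕜) • ·) h1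
  · have h1 := starMap_extD_codiff o h θ
    have h2 := starMap_codiff_extD o h θ
    refine (congrArg (starMap 𝕜 o h) (genHodge_succ_apply α β θ)).trans ?_
    refine ((starMap 𝕜 o h).map_add _ _).trans ?_
    refine Eq.trans ?_ (genHodge_succ_apply β α (starMap 𝕜 o h θ)).symm
    have e1 := ((starMap 𝕜 o h).map_smul (α : 𝕜) (extD n 𝕜 M p (codiff n 𝕜 M p θ))).trans
      (congrArg ((α : 𝕜) • ·) h1)
    have e2 := ((starMap 𝕜 o h).map_smul (β : 𝕜)
      (codiff n 𝕜 M (p + 1) (extD n 𝕜 M (p + 1) θ))).trans (congrArg ((β : 𝕜) • ·) h2)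
    exact (congrArg₂ (· + ·) e1 e2).trans (add_comm _ _)

theorem starEquiv_conj_genHodge {p q : ℕ} (o : ManifoldOrientation n M) (h : p + q = n)
    (α β : ℝ) : (starEquiv 𝕜 o h).conj (genHodge n 𝕜 M α β p) = genHodge n 𝕜 M β α q := by
  refine LinearMap.ext fun η => ?_
  rw [LinearEquiv.conj_apply_apply]
  refine (starMap_genHodge o h α β _).trans ?_
  congr 1
  exact (starEquiv 𝕜 o h).apply_symm_apply η

/-- The Hodge star restricts to isomorphisms of eigenspaces. -/
theorem spec_eq_spec {p q : ℕ} (o : ManifoldOrientation n M) (h : p + q = n) (α β : ℝ) :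
    spec n 𝕜 M α β p = spec n 𝕜 M β α q := by
  funext l
  have hmap : (Module.End.eigenspace (M := SmoothForm n 𝕜 M p) (genHodge n 𝕜 M α β p) l).map
      (starEquiv 𝕜 o h).toLinearMap =
      Module.End.eigenspace (M := SmoothForm n 𝕜 M q) (genHodge n 𝕜 M β α q) l := by
    ext η
    obtain ⟨θ, rfl⟩ := (starEquiv 𝕜 o h).surjective η
    rw [Submodule.mem_map_equiv, LinearEquiv.symm_apply_apply, Module.End.mem_eigenspace_iff,
      Module.End.mem_eigenspace_iff]
    have h1 : genHodge n 𝕜 M β α q (starEquiv 𝕜 o h θ) =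
        starEquiv 𝕜 o h (genHodge n 𝕜 M α β p θ) := (starMap_genHodge o h α β θ).symm
    rw [h1, ← map_smul, (starEquiv 𝕜 o h).injective.eq_iff]
  rw [spec, spec, ← hmap]
  exact (LinearEquiv.rank_map_eq (starEquiv 𝕜 o h) _).symm

end Conjugation

end

end GenHodge

theorem mainTheorem6 (n : ℕ) (𝕜 : Type*) [RCLike 𝕜]
    (M : Type*) [TopologicalSpace M] [T2Space M] [SigmaCompactSpace M]
    [ChartedSpace (EuclideanSpace ℝ (Fin n)) M] [IsManifold (𝓡 n) ∞ M]
    [RiemannianBundle (fun x : M => TangentSpace (𝓡 n) x)]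
    [IsContMDiffRiemannianBundle (𝓡 n) ∞ (EuclideanSpace ℝ (Fin n))
      (fun x : M => TangentSpace (𝓡 n) x)]
    [MeasurableSpace M] [BorelSpace M]
    (o : GenHodge.ManifoldOrientation n M) (α β : ℝ) (hα : 0 < α) (hβ : 0 < β) :
    (∀ p : ℕ, GenHodge.IsFormalAdjoint (GenHodge.codiff n 𝕜 M p)) ∧
    (∀ (p : ℕ) (hp : p ≤ n),
      (∃ star : GenHodge.SmoothForm n 𝕜 M p ≃ₗ[𝕜] GenHodge.SmoothForm n 𝕜 M (n - p),
        (∀ (θ : GenHodge.SmoothForm n 𝕜 M p) (x : M),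
          (star θ).1 x = GenHodge.hodgeStar (o.at_ x) (Nat.add_sub_of_le hp) (θ.1 x)) ∧
        star.conj (GenHodge.genHodge n 𝕜 M α β p) =
          GenHodge.genHodge n 𝕜 M β α (n - p)) ∧
      GenHodge.spec n 𝕜 M α β p = GenHodge.spec n 𝕜 M β α (n - p)) ∧
    (∀ p : ℕ, n = 2 * p →
      GenHodge.spec n 𝕜 M α β p = GenHodge.spec n 𝕜 M β α p) := by
  refine ⟨fun p => GenHodge.isFormalAdjoint_codiff o p, fun p hp => ⟨⟨GenHodge.starEquiv 𝕜 o
    (Nat.add_sub_of_le hp), fun _ _ => rfl, GenHodge.starEquiv_conj_genHodge o _ α β⟩,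
    GenHodge.spec_eq_spec o (Nat.add_sub_of_le hp) α β⟩, fun p hp => ?_⟩
  exact GenHodge.spec_eq_spec o (by omega) α β
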